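/- Let $n,d\ge 1$, let $\mathrm D=-\mathrm i\partial$, and consider the Cauchy problem $$\mathrm D_tU=\sum_{k=1}^nA_k(t)\,\mathrm D_{x_k}U+\mathrm iB(t)U,\quad t\ge 0,\qquad U(0,\cdot)=U_0,$$ for $U(t,x)\in\mathbb C^d$, $x\in\mathbb R^n$. The coefficients $A_k,B:[0,\infty)\to\mathbb C^{d\times d}$ are smooth and satisfy, for every $\ell\ge 0$, $$\|\partial_t^\ell A_k(t)\|+\|\partial_t^\ell B(t)\|\le C_\ell(1+t)^{-\ell}\qquad (t\ge 0).$$ Put $A(t,\xi)=\sum_{k=1}^n\xi_kA_k(t)$ and assume: (B1) the matrices $A_k(t)$ are self-adjoint and $B(t)\ge 0$ (self-adjoint, positive semidefinite) for all $t\ge 0$; (B2) for all $t\ge0$ the matrix $B(t)$ has $d$ eigenvalues $0=\delta_1(t)<\delta_2(t)<\dots<\delta_d(t)$, and $\liminf_{t\to\infty}|\delta_i(t)-\delta_j(t)|>0$ for $i\ne j$; (B3) for every choice of $\epsilon_0,\dots,\epsilon_{d-1}>0$ there are $c>0$ and $t_0\ge0$ such that $$\frac1c\|v\|^2\le\sum_{j=0}^{d-1}\epsilon_j\,\|B(t)A(t,\xi)^jv\|^2\le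 c\,\|v\|^2\qquad\text{for all }t\ge t_0,\ |\xi|=1,\ v\in\mathbb C^d.$$ Let $1\le p\le 2\le q\le\infty$ and $r\ge n\left(\frac1p-\frac1q\right)$, where in the case $p=1$ or $q=\infty$ the strict inequality $r>n\left(\frac1p-\frac1q\right)$ is required. Let $L^p_r(\mathbb R^n)=\langle\mathrm D_x\rangle^{-r}L^p(\mathbb R^n)$ be the Bessel potential space, with $\langle\mathrm D_x\rangle=(1-\Delta)^{1/2}$ and $\|u\|_{L^p_r}=\|\langle\mathrm D_x\rangle^ru\|_{L^p}$. Then there is a constant $C>0$, depending only on $n,d,p,q,r$ and the coefficients $A_k,B$, such that for all $U_0\in L^p_r(\mathbb R^n;\mathbb C^d)$ and all solutions $U\in C([0,\infty);L^2(\mathbb R^n;\mathbb C^d))$ of the Cauchy problem (in the sense of tempered distributions in $x$, for every $t\ge 0$) $$\|U(t,\cdot)\|_{L^q}\le C(1+t)^{-\frac n2\left(\frac1p-\frac1q\right)}\|U_0\|_{L^p_r}\qquad\text{for all }t\ge 0.$$ -/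

import Mathlib

open MeasureTheory TemperedDistribution Filter Set
open scoped ENNReal SchwartzMap LineDeriv ContDiff ComplexOrder

noncomputable section

namespace PartDiss

/-- The space variable `x ∈ ℝⁿ`, with its Euclidean norm. -/
abbrev Rn (n : ℕ) : Type := EuclideanSpace ℝ (Fin n)

/-- The state space `ℂᵈ`, with its Euclidean norm. -/
abbrev Cd (d : ℕ) : Type := EuclideanSpace ℂ (Fin d)

/-! ### Bessel potential spaces -/

/-- The symbol of `⟨D_x⟩ ^ r`, where `D = -i∂`. Mathlib's Fourier transform has kernel
`exp (-2πi x·ξ)`, so that `D_x` has the symbol `2πξ`. -/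
def japaneseSymbol {n : ℕ} (r : ℝ) (ξ : Rn n) : ℂ :=
  (((1 + (2 * Real.pi * ‖ξ‖) ^ 2) ^ (r / 2) : ℝ) : ℂ)

/-- The symbol has temperate growth, so that the Fourier multiplier below is not a junk value. -/
theorem japaneseSymbol_hasTemperateGrowth {n : ℕ} (r : ℝ) :
    (japaneseSymbol (n := n) r).HasTemperateGrowth := by
  have h := (Function.hasTemperateGrowth_one_add_norm_sq_rpow (Rn n) (r / 2)).comp
    (((2 * Real.pi) • ContinuousLinearMap.id ℝ (Rn n)).hasTemperateGrowth)
  have h2 := (Complex.ofRealCLM.hasTemperateGrowth).comp h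
  convert h2 using 1
  ext ξ
  simp [japaneseSymbol, norm_smul, abs_of_pos Real.pi_pos]

/-- The operator `⟨D_x⟩ ^ r = (1 - Δ) ^ (r / 2)` on `ℂᵈ`-valued tempered distributions. -/
def japaneseOp (n d : ℕ) (r : ℝ) : 𝓢'(Rn n, Cd d) →L[ℂ] 𝓢'(Rn n, Cd d) :=
  fourierMultiplierCLM (Cd d) (japaneseSymbol r)

/-- `u ∈ L^p_r = ⟨D_x⟩ ^ (-r) L^p`. -/
def MemLpr {n d : ℕ} (p : ℝ≥0∞) [Fact (1 ≤ p)] (r : ℝ) (u : 𝓢'(Rn n, Cd d)) : Prop :=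
  ∃ g : Lp (Cd d) p (volume : Measure (Rn n)), japaneseOp n d r u = g

/-- The norm `‖⟨D_x⟩ ^ r u‖_{L^p}` of `L^p_r`; the infimum runs over at most one `g`
and is `∞` when `u ∉ L^p_r`. -/
def lprNorm {n d : ℕ} (p : ℝ≥0∞) [Fact (1 ≤ p)] (r : ℝ) (u : 𝓢'(Rn n, Cd d)) : ℝ≥0∞ :=
  ⨅ (g : Lp (Cd d) p (volume : Measure (Rn n))) (_ : japaneseOp n d r u = g), ‖g‖ₑ

theorem lprNorm_eq {n d : ℕ} (p : ℝ≥0∞) [Fact (1 ≤ p)] (r : ℝ) (u : 𝓢'(Rn n, Cd d))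
    (g : Lp (Cd d) p (volume : Measure (Rn n))) (hg : japaneseOp n d r u = g) :
    lprNorm p r u = ‖g‖ₑ := by
  apply le_antisymm
  · exact iInf₂_le g hg
  · refine le_iInf₂ fun g' hg' => ?_
    have hinj := LinearMap.ker_eq_bot.1
      (Lp.ker_toTemperedDistributionCLM_eq_bot (F := Cd d) (p := p) (μ := (volume : Measure (Rn n))))
    have : g = g' := hinj (by simpa using hg.symm.trans hg')
    rw [this]

/-! ### Coefficients -/

/-- The class `𝒯{ℓ}` of smooth functions on `[0, ∞)` whose `k`-th derivative is
`O((1 + t) ^ (-ℓ - k))` for every `k`. -/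
def TClass (l : ℕ) (f : ℝ → ℂ) : Prop :=
  ContDiffOn ℝ ∞ f (Ici 0) ∧
    ∀ k : ℕ, ∃ C : ℝ, ∀ t : ℝ, 0 ≤ t →
      ‖iteratedDerivWithin k f (Ici 0) t‖ ≤ C * (1 / (1 + t)) ^ (l + k)

/-- Matrix-valued functions with all entries in `𝒯{ℓ}`. -/
def MatTClass {d : ℕ} (l : ℕ) (M : ℝ → Matrix (Fin d) (Fin d) ℂ) : Prop :=
  ∀ i j, TClass l fun t => M t i j

/-- `A(t, ξ) = ∑ₖ ξₖ Aₖ(t)`. -/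
def symbolA {n d : ℕ} (A : Fin n → ℝ → Matrix (Fin d) (Fin d) ℂ) (t : ℝ) (ξ : Rn n) :
    Matrix (Fin d) (Fin d) ℂ :=
  ∑ k, (ξ k : ℂ) • A k t

/-- (B1): the `Aₖ(t)` are self-adjoint and `B(t) ≥ 0` (in particular `B(t)` is self-adjoint). -/
def CondB1 {n d : ℕ} (A : Fin n → ℝ → Matrix (Fin d) (Fin d) ℂ)
    (B : ℝ → Matrix (Fin d) (Fin d) ℂ) : Prop :=
  ∀ t : ℝ, 0 ≤ t → (∀ k, (A k t).IsHermitian) ∧ (B t).PosSemidef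

/-- (B2): `B(t)` has `d` eigenvalues `0 = δ₁(t) < ⋯ < δ_d(t)` whose mutual distances have a
positive lower limit as `t → ∞`. -/
def CondB2 {d : ℕ} [NeZero d] (B : ℝ → Matrix (Fin d) (Fin d) ℂ) : Prop :=
  ∃ δ : Fin d → ℝ → ℝ,
    (∀ t : ℝ, 0 ≤ t →
      δ 0 t = 0 ∧ (StrictMono fun i => δ i t) ∧
        ∀ i, Module.End.HasEigenvalue (Matrix.toEuclideanLin (B t)) (δ i t : ℂ)) ∧
    ∀ i j, i ≠ j → 0 < liminf (fun t => |δ i t - δ j t|) atTop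

/-- (B3): the uniform Kalman rank condition, for `ξ` in the unit sphere. -/
def CondB3 {n d : ℕ} (A : Fin n → ℝ → Matrix (Fin d) (Fin d) ℂ)
    (B : ℝ → Matrix (Fin d) (Fin d) ℂ) : Prop :=
  ∀ ε : Fin d → ℝ, (∀ j, 0 < ε j) →
    ∃ c : ℝ, 0 < c ∧ ∃ t₀ : ℝ, 0 ≤ t₀ ∧
      ∀ t : ℝ, t₀ ≤ t → ∀ ξ : Rn n, ‖ξ‖ = 1 → ∀ v : Cd d,
        1 / c * ‖v‖ ^ 2 ≤
            ∑ j : Fin d, ε j * ‖Matrix.toEuclideanLin (B t * symbolA A t ξ ^ (j : ℕ)) v‖ ^ 2 ∧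
          ∑ j : Fin d, ε j * ‖Matrix.toEuclideanLin (B t * symbolA A t ξ ^ (j : ℕ)) v‖ ^ 2 ≤
            c * ‖v‖ ^ 2

/-! ### The Cauchy problem -/

/-- `U ∈ C([0, ∞); L²(ℝⁿ; ℂᵈ))` solves the Cauchy problem
`D_t U = ∑ₖ Aₖ(t) D_{xₖ} U + i B(t) U`, `U(0) = U₀`, where `D = -i∂`. The equation is understood
in the sense of tempered distributions in `x`, for each `t ≥ 0`: tested with `φ ∈ 𝓢`, it reads
`∂ₜ ⟨U(t), φ⟩ = i (∑ₖ Aₖ(t) (-i) ⟨∂ₖ U(t), φ⟩ + i B(t) ⟨U(t), φ⟩)`. -/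
structure IsSolution {n d : ℕ} (A : Fin n → ℝ → Matrix (Fin d) (Fin d) ℂ)
    (B : ℝ → Matrix (Fin d) (Fin d) ℂ) (U₀ : 𝓢'(Rn n, Cd d))
    (U : ℝ → Lp (Cd d) 2 (volume : Measure (Rn n))) : Prop where
  continuousOn : ContinuousOn U (Ici 0)
  initial : (U 0 : 𝓢'(Rn n, Cd d)) = U₀
  equation : ∀ φ : 𝓢(Rn n, ℂ), ∀ t : ℝ, 0 ≤ t →
    HasDerivWithinAt (fun s : ℝ => (U s : 𝓢'(Rn n, Cd d)) φ)
      (Complex.I •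
        ((∑ k, Matrix.toEuclideanLin (A k t)
            ((-Complex.I) •
              (∂_{EuclideanSpace.single k (1 : ℝ)} (U t : 𝓢'(Rn n, Cd d)) : 𝓢'(Rn n, Cd d)) φ))
          + Complex.I • Matrix.toEuclideanLin (B t) ((U t : 𝓢'(Rn n, Cd d)) φ)))
      (Ici 0) t

end PartDiss

end

/-!
On the Fourier side the system is a family of ordinary differential equations
`∂ₜ û = (2πi A(t, ξ) - B(t)) û`, along which (B1) makes `|û|²` nonincreasing. A bounded
combination of the products `Im ⟪B A ^ j û, B A ^ (j + 1) û⟫` is added to `|û|²`. With rapidly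
decreasing weights its derivative produces the sum in (B3), and the time derivatives of the
coefficients, being `O(1 / (1 + t))`, are absorbed once `(1 + t) |ξ|` is large. The result is
`|û(t, ξ)|² ≤ C exp (-γ t |ξ|² / (1 + |ξ|²)) |û(0, ξ)|²`. A distributional solution is only
continuous in time with values in `L²`, so this estimate is proved for its restrictions to annuli,
on which `A(t, ξ)` is a bounded operator on `L²`. It holds after multiplication by any bounded
function, hence almost everywhere.

The exponential absorbs `(1 + (1 + t) |ξ|²) ^ (r / 2)` at the price of `⟨ξ⟩ ^ r`, which is the
loss of derivatives. With `r = r₁ + r₂`, the weight with exponent `r₁ / 2` controls the `L^q` norm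
of the inverse Fourier transform by an `L²` norm, and the inverse weight with exponent `r₂ / 2`
controls an `L²` norm of the Fourier transform by the `L^p` norm, by duality. Scaling `ξ` by
`√(1 + t)` turns these into the factors `(1 + t) ^ (-n/2 (1/2 - 1/q))` and
`(1 + t) ^ (-n/2 (1/p - 1/2))`. The equality case `r = n (1/p - 1/q)` is Paley's inequality: the
real interpolation argument between `L² → L²` and `L¹ → L^∞` replaces the missing integrability of
the weight.
-/

namespace PartDiss

open Module (finrank)
open scoped FourierTransform

/-! ### Sobolev inequality for maps between `L²` spaces that contract `L¹` into `L^∞` -/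

section

variable {α β F : Type*} [MeasurableSpace α] [MeasurableSpace β] {μ : Measure α} {ν : Measure β}
  [NormedAddCommGroup F]

theorem eLpNorm_two_sq (f : α → F) : eLpNorm f 2 μ ^ 2 = ∫⁻ x, ‖f x‖ₑ ^ 2 ∂μ := by
  have h := eLpNorm_nnreal_pow_eq_lintegral (f := f) (μ := μ) (p := 2) two_ne_zero
  simpa only [NNReal.coe_ofNat, ENNReal.coe_ofNat, ENNReal.rpow_ofNat] using h

theorem eLpNorm_le_ofReal_of_lintegral_rpow_le {f : α → F} {p a : ℝ} (hp : 0 < p) (ha : 0 ≤ a)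
    (h : ∫⁻ x, ‖f x‖ₑ ^ p ∂μ ≤ ENNReal.ofReal (a ^ p)) :
    eLpNorm f (ENNReal.ofReal p) μ ≤ ENNReal.ofReal a := by
  rw [eLpNorm_eq_lintegral_rpow_enorm_toReal (by simpa using hp) ENNReal.ofReal_ne_top,
    ENNReal.toReal_ofReal hp.le, one_div, ENNReal.rpow_inv_le_iff hp,
    ENNReal.ofReal_rpow_of_nonneg ha hp.le]
  exact h

theorem le_ofReal_mul_of_forall_le_ofReal {C : ℝ} (hC : 0 < C) {x N : ℝ≥0∞}
    (h : ∀ κ : ℝ, 0 < κ → N ≤ ENNReal.ofReal κ → x ≤ ENNReal.ofReal (C * κ)) :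
    x ≤ ENNReal.ofReal C * N := by
  refine ENNReal.le_of_forall_pos_le_add fun ε hε hfin => ?_
  have hN : N ≠ ⊤ := fun hN => by simp [hN, ENNReal.mul_top, hC] at hfin
  have hεC : 0 < ε / C := by positivity
  have hκ : N ≤ ENNReal.ofReal (N.toReal + ε / C) :=
    (ENNReal.ofReal_toReal hN).ge.trans (ENNReal.ofReal_le_ofReal (by linarith))
  refine (h _ (by positivity) hκ).trans (le_of_eq ?_)
  rw [mul_add, mul_div_cancel₀ _ hC.ne', ENNReal.ofReal_add (by positivity) ε.coe_nonneg,
    ENNReal.ofReal_mul hC.le, ENNReal.ofReal_toReal hN, ENNReal.ofReal_coe_nnreal]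

theorem eLpNorm_one_le_eLpNorm_inv_mul_eLpNorm_smul [NormedSpace ℝ F] {w : α → ℝ} {k : α → F}
    (hw : AEStronglyMeasurable w μ) (hw0 : ∀ᵐ x ∂μ, w x ≠ 0) (hk : AEStronglyMeasurable k μ) :
    eLpNorm k 1 μ ≤ eLpNorm w⁻¹ 2 μ * eLpNorm (fun x => w x • k x) 2 μ := by
  have hwk : k =ᵐ[μ] w⁻¹ • fun x => w x • k x := by
    filter_upwards [hw0] with x hx
    rw [Pi.smul_apply', Pi.inv_apply, inv_smul_smul₀ hx]
  rw [eLpNorm_congr_ae hwk]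
  exact eLpNorm_smul_le_mul_eLpNorm (hw.smul hk) hw.aemeasurable.inv.aestronglyMeasurable

theorem lintegral_rpow_le_of_meas_lt_le {f : α → ℝ} {g : β → ℝ} (hf : 0 ≤ᵐ[μ] f)
    (hfm : AEMeasurable f μ) (hg : 0 ≤ᵐ[ν] g) (hgm : AEMeasurable g ν) {p q c : ℝ} (hq : 0 < q)
    (hpq : p < q) (hc : 0 ≤ c)
    (h : ∀ l : ℝ, 0 < l → μ {x | l < f x} ≤ ENNReal.ofReal (c / l ^ p) * ν {y | l ≤ g y}) :
    ∫⁻ x, ENNReal.ofReal (f x ^ q) ∂μ ≤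
      ENNReal.ofReal (c * q / (q - p)) * ∫⁻ y, ENNReal.ofReal (g y ^ (q - p)) ∂ν := by
  have hqp : 0 < q - p := sub_pos.2 hpq
  rw [lintegral_rpow_eq_lintegral_meas_lt_mul μ hf hfm hq,
    lintegral_rpow_eq_lintegral_meas_le_mul ν hg hgm hqp, ← mul_assoc,
    ← ENNReal.ofReal_mul (by positivity), div_mul_cancel₀ _ hqp.ne', mul_comm c,
    ENNReal.ofReal_mul hq.le, mul_assoc]
  gcongr ENNReal.ofReal q * ?_
  rw [← lintegral_const_mul' _ _ ENNReal.ofReal_ne_top]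
  refine setLIntegral_mono' measurableSet_Ioi fun l (hl : 0 < l) => ?_
  calc μ {x | l < f x} * ENNReal.ofReal (l ^ (q - 1))
      ≤ ENNReal.ofReal (c / l ^ p) * ν {y | l ≤ g y} * ENNReal.ofReal (l ^ (q - 1)) := by
        gcongr
        exact h l hl
    _ = ENNReal.ofReal (c / l ^ p * l ^ (q - 1)) * ν {y | l ≤ g y} := by
        rw [ENNReal.ofReal_mul (by positivity)]
        ring
    _ = ENNReal.ofReal (c * l ^ (q - p - 1)) * ν {y | l ≤ g y} := by
        congr 2
        rw [div_mul_eq_mul_div, mul_div_assoc, ← Real.rpow_sub hl]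
        ring_nf
    _ = _ := by
        rw [ENNReal.ofReal_mul hc]
        ring

end

/-- Maps between `L²` spaces with the two mapping properties of the Fourier transform that enter
the Sobolev inequality. -/
structure IsFourierContraction {α β F G : Type*} [MeasurableSpace α] [MeasurableSpace β]
    [NormedAddCommGroup F] [NormedAddCommGroup G] {μ : Measure α} {ν : Measure β}
    (Φ : Lp F 2 μ →+ Lp G 2 ν) : Prop where
  eLpNorm_two_le : ∀ f, eLpNorm (Φ f) 2 ν ≤ eLpNorm f 2 μ
  eLpNorm_top_le : ∀ f, eLpNorm (Φ f) ∞ ν ≤ eLpNorm f 1 μ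

namespace IsFourierContraction

variable {α β F G : Type*} [MeasurableSpace α] [MeasurableSpace β]
    [NormedAddCommGroup F] [NormedAddCommGroup G] {μ : Measure α} {ν : Measure β}
    {Φ : Lp F 2 μ →+ Lp G 2 ν}

theorem measure_lt_norm_le (hΦ : IsFourierContraction Φ) (k : Lp F 2 μ) {S : Set α}
    (hS : MeasurableSet S) {l : ℝ} (hl : 0 < l)
    (h : ∫⁻ ξ in Sᶜ, ‖k ξ‖ₑ ∂μ ≤ ENNReal.ofReal (l / 2)) :
    ν {x | l < ‖Φ k x‖} ≤ ENNReal.ofReal (4 / l ^ 2) * ∫⁻ ξ in S, ‖k ξ‖ₑ ^ 2 ∂μ := by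
  have hkS := (Lp.memLp k).indicator hS
  have hkSc := (Lp.memLp k).indicator hS.compl
  have hsplit : k = hkSc.toLp _ + hkS.toLp _ := by
    refine (Lp.toLp_coeFn k (Lp.memLp k)).symm.trans ((MemLp.toLp_congr _ _ ?_).trans
      (MemLp.toLp_add hkSc hkS))
    rw [indicator_compl_add_self]
  have hsmall : ∀ᵐ x ∂ν, ‖Φ (hkSc.toLp _) x‖ ≤ l / 2 := by
    have hbound : eLpNorm (Φ (hkSc.toLp _)) ∞ ν ≤ ENNReal.ofReal (l / 2) := by
      refine (hΦ.eLpNorm_top_le _).trans (le_trans (le_of_eq ?_) h)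
      rw [eLpNorm_congr_ae hkSc.coeFn_toLp, eLpNorm_indicator_eq_eLpNorm_restrict hS.compl,
        eLpNorm_one_eq_lintegral_enorm]
    filter_upwards [enorm_ae_le_eLpNormEssSup (Φ (hkSc.toLp _)) ν] with x hx
    rw [← ENNReal.ofReal_le_ofReal_iff (by positivity), ofReal_norm]
    exact hx.trans (by rwa [eLpNorm_exponent_top] at hbound)
  have hsub : ν {x | l < ‖Φ k x‖} ≤
      ν {x | ENNReal.ofReal (l / 2) ≤ ‖Φ (hkS.toLp _) x‖ₑ} := by
    refine measure_mono_ae ?_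
    filter_upwards [Lp.coeFn_add (Φ (hkSc.toLp _)) (Φ (hkS.toLp _)), hsmall] with x hadd hx
      (hlx : l < ‖Φ k x‖)
    rw [hsplit, map_add, hadd, Pi.add_apply] at hlx
    change ENNReal.ofReal (l / 2) ≤ ‖Φ (hkS.toLp _) x‖ₑ
    rw [← ofReal_norm, ENNReal.ofReal_le_ofReal_iff (norm_nonneg _)]
    linarith [norm_add_le (Φ (hkSc.toLp _) x) (Φ (hkS.toLp _) x)]
  have hchebyshev := meas_ge_le_mul_pow_eLpNorm_enorm ν two_ne_zero ENNReal.ofNat_ne_top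
    (Lp.aestronglyMeasurable (Φ (hkS.toLp _))) (ε := ENNReal.ofReal (l / 2)) (by simpa using hl)
    (by simp)
  rw [ENNReal.toReal_ofNat, ENNReal.rpow_two, ENNReal.rpow_two,
    ← ENNReal.ofReal_inv_of_pos (by positivity), ← ENNReal.ofReal_pow (by positivity)] at hchebyshev
  calc ν {x | l < ‖Φ k x‖}
      ≤ ENNReal.ofReal ((l / 2)⁻¹ ^ 2) * eLpNorm (Φ (hkS.toLp _)) 2 ν ^ 2 :=
        hsub.trans hchebyshev
    _ ≤ ENNReal.ofReal ((l / 2)⁻¹ ^ 2) * eLpNorm (hkS.toLp _) 2 μ ^ 2 := by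
        gcongr
        exact hΦ.eLpNorm_two_le _
    _ = _ := by
        rw [eLpNorm_congr_ae hkS.coeFn_toLp, eLpNorm_indicator_eq_eLpNorm_restrict hS,
          eLpNorm_two_sq, inv_pow, div_pow, inv_div]
        norm_num

/-- Real interpolation by hand: at height `l` the low frequencies `‖ξ‖ < (l / b) ^ θ⁻¹` of `k`
contribute at most `l / 2` in `L^∞`, and the high ones are estimated in `L²`. -/
theorem measure_lt_norm_le_withDensity {E : Type*} [NormedAddCommGroup E] [MeasurableSpace E]
    [OpensMeasurableSpace E] {μ : Measure E} {Φ : Lp F 2 μ →+ Lp G 2 ν}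
    (hΦ : IsFourierContraction Φ) (k : Lp F 2 μ) {θ b : ℝ} (hθ : 0 < θ) (hb : 0 < b)
    (hlow : ∀ R : ℝ, 0 < R →
      ∫⁻ ξ in Metric.ball 0 R, ‖k ξ‖ₑ ∂μ ≤ ENNReal.ofReal (b / 2 * R ^ θ))
    {l : ℝ} (hl : 0 < l) :
    ν {x | l < ‖Φ k x‖} ≤ ENNReal.ofReal (4 / l ^ (2 : ℝ)) *
      μ.withDensity (fun ξ => ‖k ξ‖ₑ ^ 2) {ξ | l ≤ b * ‖ξ‖ ^ θ} := by
  have hS : MeasurableSet {ξ : E | l ≤ b * ‖ξ‖ ^ θ} :=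
    measurableSet_le measurable_const (by fun_prop)
  have hcompl : {ξ : E | l ≤ b * ‖ξ‖ ^ θ}ᶜ ⊆ Metric.ball 0 ((l / b) ^ θ⁻¹) := by
    intro ξ hξ
    rw [mem_compl_iff, mem_ofPred_eq, not_le, ← lt_div_iff₀' hb] at hξ
    rw [mem_ball_zero_iff]
    exact (Real.lt_rpow_inv_iff_of_pos (norm_nonneg ξ) (by positivity) hθ).2 hξ
  rw [withDensity_apply _ hS, Real.rpow_two]
  refine hΦ.measure_lt_norm_le k hS hl ((lintegral_mono_set hcompl).trans
    ((hlow _ (by positivity)).trans (le_of_eq ?_)))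
  rw [Real.rpow_inv_rpow (by positivity) hθ.ne']
  field_simp

end IsFourierContraction

theorem lintegral_withDensity_norm_rpow_eq {E F : Type*} [NormedAddCommGroup E]
    [MeasurableSpace E] [BorelSpace E] {μ : Measure E} [NormedAddCommGroup F] [NormedSpace ℝ F]
    {k : E → F} (hk : AEStronglyMeasurable k μ) {b θ q s : ℝ} (hb : 0 ≤ b)
    (hs : θ * (q - 2) = s * 2) :
    ∫⁻ ξ, ENNReal.ofReal ((b * ‖ξ‖ ^ θ) ^ (q - 2)) ∂μ.withDensity (fun ξ => ‖k ξ‖ₑ ^ 2) =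
      ENNReal.ofReal (b ^ (q - 2)) * eLpNorm (fun ξ => ‖ξ‖ ^ s • k ξ) 2 μ ^ 2 := by
  rw [lintegral_withDensity_eq_lintegral_mul₀ (by fun_prop) (by fun_prop), eLpNorm_two_sq,
    ← lintegral_const_mul' _ _ ENNReal.ofReal_ne_top]
  refine lintegral_congr fun ξ => ?_
  rw [Pi.mul_apply, Real.mul_rpow hb (by positivity), ← Real.rpow_mul (norm_nonneg _), hs,
    ENNReal.ofReal_mul (by positivity), enorm_smul, mul_pow,
    Real.enorm_eq_ofReal (by positivity), ← ENNReal.ofReal_pow (by positivity),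
    ← Real.rpow_mul_natCast (norm_nonneg _)]
  push_cast
  ring

section

variable {E : Type*} [NormedAddCommGroup E] [NormedSpace ℝ E] [FiniteDimensional ℝ E]
  [MeasurableSpace E] [BorelSpace E] {μ : Measure E} [μ.IsAddHaarMeasure]
  {F : Type*} [NormedAddCommGroup F] [NormedSpace ℝ F]

theorem exists_setLIntegral_ball_norm_rpow_le [Nontrivial E] {a : ℝ} (ha : a < finrank ℝ E) :
    ∃ c : ℝ, 0 < c ∧ ∀ R : ℝ, 0 < R →
      ∫⁻ ξ in Metric.ball (0 : E) R, ENNReal.ofReal (‖ξ‖ ^ (-a)) ∂μ ≤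
        ENNReal.ofReal (c * R ^ (finrank ℝ E - a)) := by
  set I := ∫ ξ in Metric.ball (0 : E) 1, ‖ξ‖ ^ (-a) ∂μ with hI
  have hI_nonneg : 0 ≤ I := integral_nonneg fun ξ => by positivity
  refine ⟨I + 1, add_pos_of_nonneg_of_pos hI_nonneg one_pos, fun R hR => ?_⟩
  have hint : IntegrableOn (fun ξ : E => ‖ξ‖ ^ (-a)) (Metric.ball 0 R) μ :=
    integrableOn_ball_of_norm_le_rpow (C := 1) Module.finrank_pos ha
      (.of_forall fun ξ => by rw [one_mul, Real.norm_of_nonneg (by positivity)])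
      (by fun_prop : Measurable fun ξ : E => ‖ξ‖ ^ (-a)).aestronglyMeasurable
  rw [← ofReal_integral_eq_lintegral_ofReal hint (.of_forall fun ξ => by positivity)]
  have hscale : R ^ (-a) * I =
      (R ^ finrank ℝ E)⁻¹ * ∫ ξ in Metric.ball (0 : E) R, ‖ξ‖ ^ (-a) ∂μ := by
    have h := Measure.setIntegral_comp_smul_of_pos μ (fun ξ : E => ‖ξ‖ ^ (-a))
      (Metric.ball 0 1) hR
    rw [smul_unitBall hR.ne', Real.norm_of_nonneg hR.le, smul_eq_mul] at h
    rw [← h, hI, ← integral_const_mul]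
    exact integral_congr_ae <| .of_forall fun ξ => by
      simp only [norm_smul, Real.norm_of_nonneg hR.le, Real.mul_rpow hR.le (norm_nonneg ξ)]
  have hball : ∫ ξ in Metric.ball (0 : E) R, ‖ξ‖ ^ (-a) ∂μ = I * R ^ (finrank ℝ E - a) := by
    rw [eq_inv_mul_iff_mul_eq₀ (by positivity)] at hscale
    rw [← hscale, sub_eq_add_neg, Real.rpow_add hR, Real.rpow_natCast]
    ring
  rw [hball]
  gcongr
  linarith

theorem exists_setLIntegral_ball_enorm_le [Nontrivial E] {s : ℝ} (hs : 2 * s < finrank ℝ E) :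
    ∃ c : ℝ, 0 < c ∧ ∀ (R : ℝ) (k : E → F), 0 < R → AEStronglyMeasurable k μ →
      ∫⁻ ξ in Metric.ball 0 R, ‖k ξ‖ₑ ∂μ ≤ ENNReal.ofReal (c * R ^ (finrank ℝ E / 2 - s)) *
        eLpNorm (fun ξ => ‖ξ‖ ^ s • k ξ) 2 μ := by
  obtain ⟨c, hc, hball⟩ := exists_setLIntegral_ball_norm_rpow_le (μ := μ) hs
  refine ⟨√c, by positivity, fun R k hR hk => ?_⟩
  have hne : ∀ᵐ ξ ∂μ.restrict (Metric.ball (0 : E) R), ‖ξ‖ ^ s ≠ 0 := by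
    filter_upwards [ae_restrict_of_ae (Measure.ae_ne μ 0)] with ξ hξ
    exact (Real.rpow_pos_of_pos (norm_pos_iff.2 hξ) s).ne'
  have hinv : eLpNorm (fun ξ : E => ‖ξ‖ ^ s)⁻¹ 2 (μ.restrict (Metric.ball 0 R)) ≤
      ENNReal.ofReal (√c * R ^ (finrank ℝ E / 2 - s)) := by
    rw [← ENNReal.ofReal_ofNat 2]
    refine eLpNorm_le_ofReal_of_lintegral_rpow_le two_pos (by positivity) ?_
    calc ∫⁻ ξ in Metric.ball (0 : E) R, ‖(‖ξ‖ ^ s)⁻¹‖ₑ ^ (2 : ℝ) ∂μ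
        = ∫⁻ ξ in Metric.ball (0 : E) R, ENNReal.ofReal (‖ξ‖ ^ (-(2 * s))) ∂μ := by
          refine lintegral_congr fun ξ => ?_
          rw [Real.enorm_eq_ofReal (by positivity),
            ENNReal.ofReal_rpow_of_nonneg (by positivity) two_pos.le,
            ← Real.rpow_neg (norm_nonneg ξ), ← Real.rpow_mul (norm_nonneg ξ)]
          ring_nf
      _ ≤ ENNReal.ofReal (c * R ^ (finrank ℝ E - 2 * s)) := hball R hR
      _ = _ := by
          rw [Real.rpow_two, mul_pow, Real.sq_sqrt hc.le, ← Real.rpow_mul_natCast hR.le]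
          push_cast
          ring_nf
  have hmeas : Measurable fun ξ : E => ‖ξ‖ ^ s := by fun_prop
  rw [← eLpNorm_one_eq_lintegral_enorm]
  refine (eLpNorm_one_le_eLpNorm_inv_mul_eLpNorm_smul hmeas.aestronglyMeasurable hne
    hk.restrict).trans ?_
  gcongr
  exact Measure.restrict_le_self

namespace IsFourierContraction

variable {β G : Type*} [MeasurableSpace β] [NormedAddCommGroup G] {ν : Measure β}

theorem exists_eLpNorm_le_norm_rpow_smul [Nontrivial E] {q : ℝ} (hq : 2 < q) :
    ∃ C : ℝ, 0 < C ∧ ∀ (Φ : Lp F 2 μ →+ Lp G 2 ν), IsFourierContraction Φ → ∀ k : Lp F 2 μ,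
      eLpNorm (Φ k) (ENNReal.ofReal q) ν ≤ ENNReal.ofReal C *
        eLpNorm (fun ξ => ‖ξ‖ ^ (finrank ℝ E / 2 - finrank ℝ E / q : ℝ) • k ξ) 2 μ := by
  have hn : (0 : ℝ) < finrank ℝ E := by exact_mod_cast Module.finrank_pos
  have hq0 : 0 < q := by linarith
  have hq2 : 0 < q - 2 := by linarith
  have hnq : 0 < finrank ℝ E / q := by positivity
  set s : ℝ := finrank ℝ E / 2 - finrank ℝ E / q with hs
  have hexp : finrank ℝ E / q * (q - 2) = s * 2 := by rw [hs]; field_simp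
  obtain ⟨c, hc, hball⟩ := exists_setLIntegral_ball_enorm_le (μ := μ) (F := F) (s := s)
    (by linarith)
  have hC : 0 < (4 * q / (q - 2) * (2 * c) ^ (q - 2)) ^ q⁻¹ := by positivity
  refine ⟨_, hC, fun Φ hΦ k => le_ofReal_mul_of_forall_le_ofReal hC fun κ hκ hkκ => ?_⟩
  refine eLpNorm_le_ofReal_of_lintegral_rpow_le hq0 (by positivity) ?_
  have hlow : ∀ R : ℝ, 0 < R → ∫⁻ ξ in Metric.ball 0 R, ‖k ξ‖ₑ ∂μ ≤
      ENNReal.ofReal (2 * c * κ / 2 * R ^ (finrank ℝ E / q)) := fun R hR => by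
    refine (hball R k hR (Lp.aestronglyMeasurable k)).trans ((mul_le_mul_right hkκ _).trans ?_)
    rw [← ENNReal.ofReal_mul (by positivity), hs, sub_sub_cancel]
    exact (congrArg _ (by ring)).le
  have hhigh := (lintegral_withDensity_norm_rpow_eq (μ := μ) (Lp.aestronglyMeasurable k)
    (b := 2 * c * κ) (by positivity) hexp).trans_le
      (mul_le_mul_right (pow_le_pow_left₀ zero_le hkκ 2) _)
  calc ∫⁻ x, ‖Φ k x‖ₑ ^ q ∂ν = ∫⁻ x, ENNReal.ofReal (‖Φ k x‖ ^ q) ∂ν := by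
        simp_rw [← ofReal_norm, ENNReal.ofReal_rpow_of_nonneg (norm_nonneg _) hq0.le]
    _ ≤ ENNReal.ofReal (4 * q / (q - 2)) *
          (ENNReal.ofReal ((2 * c * κ) ^ (q - 2)) * ENNReal.ofReal κ ^ 2) := by
        refine (lintegral_rpow_le_of_meas_lt_le (.of_forall fun x => norm_nonneg _)
          (Lp.aestronglyMeasurable _).norm.aemeasurable (.of_forall fun ξ => by positivity)
          (by fun_prop) hq0 hq four_pos.le fun l hl =>
            hΦ.measure_lt_norm_le_withDensity k hnq (by positivity) hlow hl).trans ?_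
        gcongr
    _ = _ := by
        rw [← ENNReal.ofReal_pow hκ.le, ← ENNReal.ofReal_mul (by positivity),
          ← ENNReal.ofReal_mul (by positivity), Real.mul_rpow hC.le hκ.le,
          Real.rpow_inv_rpow (by positivity) hq0.ne', Real.mul_rpow (by positivity) hκ.le,
          ← sub_add_cancel q 2, Real.rpow_add hκ, Real.rpow_two]
        ring_nf

end IsFourierContraction

end

/-! ### Weighted estimates for the Fourier transform -/

section

variable {E : Type*} [NormedAddCommGroup E] [InnerProductSpace ℝ E] [FiniteDimensional ℝ E]
  [MeasurableSpace E] [BorelSpace E] {F : Type*} [NormedAddCommGroup F]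

theorem eLpNorm_top_le_of_integral_smul_eq_fourierIntegral [NormedSpace ℂ F] [CompleteSpace F]
    {L : E →ₗ[ℝ] E →ₗ[ℝ] ℝ} (hL : Continuous fun x : E × E => L x.1 x.2) {f u : E → F}
    (hf : AEStronglyMeasurable f) (hu : LocallyIntegrable u)
    (h : ∀ g : 𝓢(E, ℂ), ∫ x, g x • u x =
      ∫ x, VectorFourier.fourierIntegral Real.fourierChar volume L g x • f x) :
    eLpNorm u ∞ volume ≤ eLpNorm f 1 volume := by
  rcases eq_or_ne (eLpNorm f 1 volume) ⊤ with htop | htop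
  · rw [htop]
    exact le_top
  have hfi : Integrable f := memLp_one_iff_integrable.1 ⟨hf, htop.lt_top⟩
  have hLflip : Continuous fun x : E × E => L.flip x.1 x.2 := hL.comp continuous_swap
  have hcont : Continuous (VectorFourier.fourierIntegral Real.fourierChar volume L.flip f) :=
    VectorFourier.fourierIntegral_continuous Real.continuous_fourierChar hLflip hfi
  have hae : u =ᵐ[volume] VectorFourier.fourierIntegral Real.fourierChar volume L.flip f := by
    refine ae_eq_of_integral_contDiff_smul_eq hu hcont.locallyIntegrable fun g hg hgs => ?_
    have hgs' : HasCompactSupport (Complex.ofRealCLM ∘ g) := hgs.comp_left rfl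
    have hg' : ContDiff ℝ ∞ (Complex.ofRealCLM ∘ g) := by fun_prop
    simpa using (h (hgs'.toSchwartzMap hg')).trans
      (VectorFourier.integral_fourierIntegral_smul_eq_flip (μ := volume) (ν := volume)
        Real.continuous_fourierChar hL (SchwartzMap.integrable _) hfi)
  rw [eLpNorm_congr_ae hae, eLpNorm_exponent_top, eLpNorm_one_eq_lintegral_enorm]
  refine eLpNormEssSup_le_of_ae_enorm_bound (.of_forall fun x => ?_)
  rw [← ofReal_integral_norm_eq_lintegral_enorm hfi, ← ofReal_norm]
  exact ENNReal.ofReal_le_ofReal (VectorFourier.norm_fourierIntegral_le_integral_norm ..)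

variable [InnerProductSpace ℂ F] [CompleteSpace F]

theorem eLpNorm_fourier_top_le (f : Lp F 2 (volume : Measure E)) :
    eLpNorm (𝓕 f : Lp F 2 (volume : Measure E)) ∞ volume ≤ eLpNorm f 1 volume := by
  refine eLpNorm_top_le_of_integral_smul_eq_fourierIntegral (L := innerₗ E) continuous_inner
    (Lp.aestronglyMeasurable f) ((Lp.memLp _).locallyIntegrable one_le_two) fun g => ?_
  rw [← Lp.toTemperedDistribution_apply, ← Lp.fourier_toTemperedDistribution_eq,
    TemperedDistribution.fourier_apply, Lp.toTemperedDistribution_apply, SchwartzMap.fourier_coe]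
  rfl

theorem eLpNorm_fourierInv_top_le (f : Lp F 2 (volume : Measure E)) :
    eLpNorm (𝓕⁻ f : Lp F 2 (volume : Measure E)) ∞ volume ≤ eLpNorm f 1 volume := by
  refine eLpNorm_top_le_of_integral_smul_eq_fourierIntegral (L := -innerₗ E) continuous_inner.neg
    (Lp.aestronglyMeasurable f) ((Lp.memLp _).locallyIntegrable one_le_two) fun g => ?_
  rw [← Lp.toTemperedDistribution_apply, ← Lp.fourierInv_toTemperedDistribution_eq,
    TemperedDistribution.fourierInv_apply, Lp.toTemperedDistribution_apply,
    SchwartzMap.fourierInv_coe]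
  rfl

theorem isFourierContraction_fourierTransform :
    IsFourierContraction (Lp.fourierTransformₗᵢ E F :
      Lp F 2 (volume : Measure E) →+ Lp F 2 (volume : Measure E)) where
  eLpNorm_two_le f := by
    have h := (Lp.fourierTransformₗᵢ E F).enorm_map f
    rw [Lp.enorm_def, Lp.enorm_def] at h
    exact h.le
  eLpNorm_top_le f := eLpNorm_fourier_top_le f

theorem isFourierContraction_fourierTransform_symm :
    IsFourierContraction ((Lp.fourierTransformₗᵢ E F).symm :
      Lp F 2 (volume : Measure E) →+ Lp F 2 (volume : Measure E)) where
  eLpNorm_two_le f := by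
    have h := (Lp.fourierTransformₗᵢ E F).symm.enorm_map f
    rw [Lp.enorm_def, Lp.enorm_def] at h
    exact h.le
  eLpNorm_top_le f := eLpNorm_fourierInv_top_le f

end

/-- The weight `(1 + T |ξ|²) ^ s`: a Bessel weight rescaled to frequencies of size `T ^ (-1 / 2)`,
which are the last to decay at time `T`. -/
noncomputable def scaledWeight {E : Type*} [Norm E] (T s : ℝ) (ξ : E) : ℝ :=
  (1 + T * ‖ξ‖ ^ 2) ^ s

theorem scaledWeight_pos {E : Type*} [Norm E] {T : ℝ} (hT : 0 ≤ T) (s : ℝ) (ξ : E) :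
    0 < scaledWeight T s ξ := by
  unfold scaledWeight
  positivity

theorem scaledWeight_add {E : Type*} [Norm E] {T : ℝ} (hT : 0 ≤ T) (s s' : ℝ) (ξ : E) :
    scaledWeight T (s + s') ξ = scaledWeight T s ξ * scaledWeight T s' ξ :=
  Real.rpow_add (by positivity) s s'

theorem scaledWeight_neg {E : Type*} [Norm E] {T : ℝ} (hT : 0 ≤ T) (s : ℝ) (ξ : E) :
    scaledWeight T (-s) ξ = (scaledWeight T s ξ)⁻¹ :=
  Real.rpow_neg (by positivity) s

theorem continuous_scaledWeight {E : Type*} [SeminormedAddCommGroup E] {T : ℝ} (hT : 0 ≤ T)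
    (s : ℝ) : Continuous (scaledWeight T s : E → ℝ) :=
  (by fun_prop : Continuous fun ξ : E => 1 + T * ‖ξ‖ ^ 2).rpow_const fun ξ =>
    .inl (by positivity)

theorem scaledWeight_hasTemperateGrowth {E : Type*} [NormedAddCommGroup E] [InnerProductSpace ℝ E]
    {T : ℝ} (hT : 0 ≤ T) (s : ℝ) :
    (fun ξ : E => (scaledWeight T s ξ : ℂ)).HasTemperateGrowth := by
  have h := Complex.ofRealCLM.hasTemperateGrowth.comp
    ((Function.hasTemperateGrowth_one_add_norm_sq_rpow E s).comp
      (√T • ContinuousLinearMap.id ℝ E).hasTemperateGrowth)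
  convert h using 1
  ext ξ
  simp [scaledWeight, norm_smul, mul_pow, Real.sq_sqrt hT]

theorem norm_rpow_le_scaledWeight {E : Type*} [SeminormedAddCommGroup E] {T s ρ : ℝ} (hT : 0 < T)
    (hs : 0 ≤ s) (hsρ : s ≤ ρ) (ξ : E) :
    ‖ξ‖ ^ s ≤ T ^ (-(s / 2)) * scaledWeight T (ρ / 2) ξ := by
  have hTξ : 0 ≤ T * ‖ξ‖ ^ 2 := by positivity
  calc ‖ξ‖ ^ s = T ^ (-(s / 2)) * (T * ‖ξ‖ ^ 2) ^ (s / 2) := by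
        rw [Real.mul_rpow hT.le (by positivity), ← mul_assoc, ← Real.rpow_add hT, neg_add_cancel,
          Real.rpow_zero, one_mul, ← Real.rpow_two, ← Real.rpow_mul (norm_nonneg ξ),
          mul_div_cancel₀ _ two_ne_zero]
    _ ≤ T ^ (-(s / 2)) * (1 + T * ‖ξ‖ ^ 2) ^ (s / 2) := by
        gcongr
        linarith
    _ ≤ T ^ (-(s / 2)) * scaledWeight T (ρ / 2) ξ := by
        unfold scaledWeight
        gcongr
        linarith

theorem IsFourierContraction.eLpNorm_two_le_scaledWeight_smul {E F β G : Type*}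
    [NormedAddCommGroup E] [MeasurableSpace E] {μ : Measure E} [NormedAddCommGroup F]
    [NormedSpace ℝ F] [MeasurableSpace β] [NormedAddCommGroup G] {ν : Measure β}
    {Φ : Lp F 2 μ →+ Lp G 2 ν} (hΦ : IsFourierContraction Φ)
    (k : Lp F 2 μ) {T ρ : ℝ} (hT : 0 ≤ T) (hρ : 0 ≤ ρ) :
    eLpNorm (Φ k) 2 ν ≤ eLpNorm (fun ξ => scaledWeight T (ρ / 2) ξ • k ξ) 2 μ := by
  refine (hΦ.eLpNorm_two_le k).trans (eLpNorm_mono fun ξ => ?_)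
  have hTξ : 0 ≤ T * ‖ξ‖ ^ 2 := by positivity
  rw [norm_smul, Real.norm_of_nonneg (scaledWeight_pos hT _ ξ).le]
  exact le_mul_of_one_le_left (norm_nonneg _) (Real.one_le_rpow (by linarith) (by linarith))

section

variable {E : Type*} [NormedAddCommGroup E] [NormedSpace ℝ E] [FiniteDimensional ℝ E]
  [MeasurableSpace E] [BorelSpace E] {μ : Measure E} [μ.IsAddHaarMeasure]

theorem exists_lintegral_scaledWeight_eq {ρ : ℝ} (hρ : (finrank ℝ E : ℝ) / 2 < ρ) :
    ∃ c : ℝ, 0 ≤ c ∧ ∀ T : ℝ, 0 < T → ∫⁻ ξ : E, ENNReal.ofReal (scaledWeight T (-ρ) ξ) ∂μ =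
      ENNReal.ofReal (c * T ^ (-(finrank ℝ E / 2 : ℝ))) := by
  have hint : Integrable (fun ξ : E => (1 + ‖ξ‖ ^ 2) ^ (-ρ)) μ := by
    have h := integrable_rpow_neg_one_add_norm_sq (μ := μ) (r := 2 * ρ) (by linarith)
    convert h using 3
    ring
  refine ⟨∫ ξ : E, (1 + ‖ξ‖ ^ 2) ^ (-ρ) ∂μ, integral_nonneg fun ξ => by positivity,
    fun T hT => ?_⟩
  have hsqrt : 0 < √T := by positivity
  have hdilate : (scaledWeight T (-ρ) : E → ℝ) =
      fun ξ => (fun η : E => (1 + ‖η‖ ^ 2) ^ (-ρ)) (√T • ξ) := by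
    ext ξ
    simp only [scaledWeight, norm_smul, mul_pow, Real.norm_of_nonneg hsqrt.le, Real.sq_sqrt hT.le]
  rw [hdilate, ← ofReal_integral_eq_lintegral_ofReal (hint.comp_smul hsqrt.ne')
    (.of_forall fun ξ => by positivity),
    Measure.integral_comp_smul μ fun η : E => (1 + ‖η‖ ^ 2) ^ (-ρ), smul_eq_mul, mul_comm,
    abs_of_pos (by positivity), Real.sqrt_eq_rpow, ← Real.rpow_natCast, ← Real.rpow_mul hT.le,
    Real.rpow_neg hT.le]
  ring_nf

namespace IsFourierContraction

variable {F β G : Type*} [NormedAddCommGroup F] [NormedSpace ℝ F] [MeasurableSpace β]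
  [NormedAddCommGroup G] {ν : Measure β}

theorem exists_eLpNorm_top_le_scaledWeight_smul {ρ : ℝ} (hρ : (finrank ℝ E : ℝ) / 2 < ρ) :
    ∃ C : ℝ, 0 < C ∧ ∀ Φ : Lp F 2 μ →+ Lp G 2 ν, IsFourierContraction Φ →
      ∀ (k : Lp F 2 μ) (T : ℝ), 0 < T →
        eLpNorm (Φ k) ∞ ν ≤ ENNReal.ofReal (C * T ^ (-(finrank ℝ E / 4 : ℝ))) *
          eLpNorm (fun ξ => scaledWeight T (ρ / 2) ξ • k ξ) 2 μ := by
  obtain ⟨c, hc, hcT⟩ := exists_lintegral_scaledWeight_eq (μ := μ) hρ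
  refine ⟨√(c + 1), by positivity, fun Φ hΦ k T hT => (hΦ.eLpNorm_top_le k).trans ?_⟩
  refine (eLpNorm_one_le_eLpNorm_inv_mul_eLpNorm_smul
    (continuous_scaledWeight hT.le (ρ / 2)).aestronglyMeasurable
    (.of_forall fun ξ => (scaledWeight_pos hT.le _ ξ).ne') (Lp.aestronglyMeasurable k)).trans ?_
  gcongr
  rw [← ENNReal.ofReal_ofNat 2]
  refine eLpNorm_le_ofReal_of_lintegral_rpow_le two_pos (by positivity) ?_
  calc ∫⁻ ξ, ‖(scaledWeight T (ρ / 2) ξ)⁻¹‖ₑ ^ (2 : ℝ) ∂μ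
      = ∫⁻ ξ, ENNReal.ofReal (scaledWeight T (-ρ) ξ) ∂μ := by
        refine lintegral_congr fun ξ => ?_
        have hpos := scaledWeight_pos hT.le (-(ρ / 2)) ξ
        rw [← scaledWeight_neg hT.le, Real.enorm_eq_ofReal hpos.le, ENNReal.rpow_two, sq,
          ← ENNReal.ofReal_mul hpos.le, ← scaledWeight_add hT.le]
        ring_nf
    _ = ENNReal.ofReal (c * T ^ (-(finrank ℝ E / 2 : ℝ))) := hcT T hT
    _ ≤ ENNReal.ofReal ((c + 1) * T ^ (-(finrank ℝ E / 2 : ℝ))) := by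
        gcongr
        linarith
    _ = _ := by
        rw [Real.rpow_two, mul_pow, Real.sq_sqrt (by positivity), ← Real.rpow_mul_natCast hT.le]
        push_cast
        ring_nf

theorem exists_eLpNorm_le_scaledWeight_smul_of_lt [Nontrivial E] {q ρ : ℝ} (hq : 2 < q)
    (hρ : finrank ℝ E * (1 / 2 - q⁻¹) ≤ ρ) :
    ∃ C : ℝ, 0 < C ∧ ∀ Φ : Lp F 2 μ →+ Lp G 2 ν, IsFourierContraction Φ →
      ∀ (k : Lp F 2 μ) (T : ℝ), 0 < T → eLpNorm (Φ k) (ENNReal.ofReal q) ν ≤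
        ENNReal.ofReal (C * T ^ (-(finrank ℝ E / 2 * (1 / 2 - q⁻¹) : ℝ))) *
          eLpNorm (fun ξ => scaledWeight T (ρ / 2) ξ • k ξ) 2 μ := by
  obtain ⟨C, hC, hCΦ⟩ :=
    exists_eLpNorm_le_norm_rpow_smul (μ := μ) (ν := ν) (F := F) (G := G) hq
  refine ⟨C, hC, fun Φ hΦ k T hT => (hCΦ Φ hΦ k).trans ?_⟩
  set s : ℝ := finrank ℝ E / 2 - finrank ℝ E / q
  have hs_eq : finrank ℝ E * (1 / 2 - q⁻¹) = s := by ring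
  have hs0 : 0 ≤ s := hs_eq ▸ mul_nonneg (Nat.cast_nonneg _)
    (sub_nonneg.2 (by rw [one_div]; exact inv_anti₀ two_pos hq.le))
  rw [ENNReal.ofReal_mul hC.le, mul_assoc]
  gcongr
  refine eLpNorm_le_mul_eLpNorm_of_ae_le_mul (.of_forall fun ξ => ?_) 2
  rw [norm_smul, norm_smul, Real.norm_of_nonneg (by positivity),
    Real.norm_of_nonneg (scaledWeight_pos hT.le _ ξ).le, ← mul_assoc]
  gcongr
  have hexp : (finrank ℝ E : ℝ) / 2 * (1 / 2 - q⁻¹) = s / 2 := by rw [← hs_eq]; ring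
  rw [hexp]
  exact norm_rpow_le_scaledWeight hT hs0 (hs_eq ▸ hρ) ξ

theorem exists_eLpNorm_le_scaledWeight_smul [Nontrivial E] {q : ℝ≥0∞} (hq : 2 ≤ q) {ρ : ℝ}
    (hρ : finrank ℝ E * (1 / 2 - (q⁻¹).toReal) ≤ ρ)
    (hρ' : q = ⊤ → finrank ℝ E * (1 / 2 - (q⁻¹).toReal) < ρ) :
    ∃ C : ℝ, 0 < C ∧ ∀ Φ : Lp F 2 μ →+ Lp G 2 ν, IsFourierContraction Φ →
      ∀ (k : Lp F 2 μ) (T : ℝ), 0 < T → eLpNorm (Φ k) q ν ≤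
        ENNReal.ofReal (C * T ^ (-(finrank ℝ E / 2 * (1 / 2 - (q⁻¹).toReal) : ℝ))) *
          eLpNorm (fun ξ => scaledWeight T (ρ / 2) ξ • k ξ) 2 μ := by
  rcases eq_or_ne q ⊤ with rfl | hqt
  · have hρ_top := hρ' rfl
    rw [ENNReal.inv_top, ENNReal.toReal_zero, sub_zero, mul_one_div] at hρ_top
    convert! exists_eLpNorm_top_le_scaledWeight_smul (μ := μ) (ν := ν) (F := F) (G := G) hρ_top
      using 13
    rw [ENNReal.inv_top, ENNReal.toReal_zero]
    ring
  rcases hq.eq_or_lt with rfl | hq2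
  · have hρ0 : 0 ≤ ρ := by simpa using hρ
    refine ⟨1, one_pos, fun Φ hΦ k T hT => ?_⟩
    simpa using hΦ.eLpNorm_two_le_scaledWeight_smul k hT.le hρ0
  · lift q to NNReal using hqt
    have h2 : (2 : ℝ) < q := by exact_mod_cast hq2
    have hinv : ((q : ℝ≥0∞)⁻¹).toReal = (q : ℝ)⁻¹ := by simp
    rw [hinv] at hρ ⊢
    simpa only [ENNReal.ofReal_coe_nnreal] using
      exists_eLpNorm_le_scaledWeight_smul_of_lt (μ := μ) (ν := ν) (F := F) (G := G) h2 hρ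

end IsFourierContraction

end

section

variable {α : Type*} [MeasurableSpace α] {μ : Measure α} {F : Type*} [NormedAddCommGroup F]
  [InnerProductSpace ℂ F] [FiniteDimensional ℂ F]

theorem exists_Lp_two_integral_mul_eq (T : Lp ℂ 2 μ →L[ℂ] ℂ) :
    ∃ h : Lp ℂ 2 μ, ‖h‖ ≤ ‖T‖ ∧ ∀ φ : Lp ℂ 2 μ, ∫ x, φ x * h x ∂μ = T φ := by
  refine ⟨star ((InnerProductSpace.toDual ℂ _).symm T), ?_, fun φ => ?_⟩
  · rw [← LinearIsometryEquiv.norm_map (InnerProductSpace.toDual ℂ _).symm T, Lp.norm_def,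
      Lp.norm_def, eLpNorm_congr_ae (Lp.coeFn_star _), eLpNorm_star]
  · rw [← InnerProductSpace.toDual_symm_apply, L2.inner_def]
    refine integral_congr_ae ?_
    filter_upwards [Lp.coeFn_star ((InnerProductSpace.toDual ℂ _).symm T)] with x hx
    rw [hx]
    simp

theorem exists_Lp_two_integral_smul_eq (T : Lp ℂ 2 μ →L[ℂ] F) :
    ∃ f : Lp F 2 μ, ‖f‖ ≤ finrank ℂ F * ‖T‖ ∧ ∀ φ : Lp ℂ 2 μ, ∫ x, φ x • f x ∂μ = T φ := by
  let b := stdOrthonormalBasis ℂ F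
  choose h hnorm hT using fun i => exists_Lp_two_integral_mul_eq (innerSL ℂ (b i) ∘L T)
  let e : Fin (finrank ℂ F) → ℂ →L[ℂ] F := fun i => .toSpanSingleton ℂ (b i)
  have he : ∀ i, ‖(e i).compLp (h i)‖ ≤ ‖T‖ := fun i => by
    calc ‖(e i).compLp (h i)‖ ≤ ‖e i‖ * ‖h i‖ := ContinuousLinearMap.norm_compLp_le ..
      _ = ‖h i‖ := by
          rw [ContinuousLinearMap.norm_toSpanSingleton, b.orthonormal.norm_eq_one, one_mul]
      _ ≤ ‖innerSL ℂ (b i)‖ * ‖T‖ := (hnorm i).trans (ContinuousLinearMap.opNorm_comp_le ..)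
      _ = ‖T‖ := by rw [innerSL_apply_norm, b.orthonormal.norm_eq_one, one_mul]
  refine ⟨∑ i, (e i).compLp (h i), ?_, fun φ => ?_⟩
  · calc ‖∑ i, (e i).compLp (h i)‖ ≤ ∑ _i : Fin (finrank ℂ F), ‖T‖ :=
          norm_sum_le_of_le _ fun i _ => he i
      _ = finrank ℂ F * ‖T‖ := by simp
  · have hint : ∀ i, Integrable (fun x => φ x * h i x) μ := fun i =>
      memLp_one_iff_integrable.1 ((Lp.memLp (h i)).mul (Lp.memLp φ))
    calc ∫ x, φ x • (∑ i, (e i).compLp (h i)) x ∂μ = ∫ x, ∑ i, (φ x * h i x) • b i ∂μ := by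
          refine integral_congr_ae ?_
          filter_upwards [Lp.coeFn_finsetSum Finset.univ fun i => (e i).compLp (h i),
            ae_all_iff.2 fun i => (e i).coeFn_compLp (h i)] with x hsum hcomp
          simp only [hsum, Finset.sum_apply, hcomp, e, ContinuousLinearMap.toSpanSingleton_apply,
            Finset.smul_sum, mul_smul]
      _ = ∑ i, (∫ x, φ x * h i x ∂μ) • b i := by
          rw [integral_finsetSum _ fun i _ => (hint i).smul_const _]
          simp_rw [integral_smul_const]
      _ = T φ := by
          simp only [hT, ContinuousLinearMap.comp_apply, innerSL_apply_apply]
          exact b.sum_repr' (T φ)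

end

section

variable {E : Type*} [NormedAddCommGroup E] [InnerProductSpace ℝ E] [FiniteDimensional ℝ E]
  [MeasurableSpace E] [BorelSpace E] {F : Type*} [NormedAddCommGroup F]

theorem enorm_toTemperedDistribution_apply_le [NormedSpace ℂ F] [CompleteSpace F]
    {p : ℝ≥0∞} [hp : Fact (1 ≤ p)]
    (g : Lp F p (volume : Measure E)) (φ : 𝓢(E, ℂ)) :
    ‖(g : 𝓢'(E, F)) φ‖ₑ ≤ eLpNorm φ (1 - p⁻¹)⁻¹ volume * ‖g‖ₑ := by
  have hconj : ENNReal.HolderConjugate p (1 - p⁻¹)⁻¹ := .inv_one_sub_inv' hp.out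
  have : ENNReal.HolderTriple (1 - p⁻¹)⁻¹ p 1 := hconj.symm
  rw [Lp.toTemperedDistribution_apply, Lp.enorm_def]
  refine (enorm_integral_le_lintegral_enorm _).trans ?_
  rw [← eLpNorm_one_eq_lintegral_enorm]
  exact eLpNorm_smul_le_mul_eLpNorm (Lp.aestronglyMeasurable g)
    φ.continuous.aestronglyMeasurable

variable [InnerProductSpace ℂ F] [FiniteDimensional ℂ F]

theorem exists_Lp_two_eq_of_norm_apply_le (u : 𝓢'(E, F)) {K : ℝ} (hK : 0 ≤ K)
    (hu : ∀ ψ : 𝓢(E, ℂ), ‖u ψ‖ ≤ K * ‖ψ.toLp 2 (volume : Measure E)‖) :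
    ∃ f : Lp F 2 (volume : Measure E), u = f ∧ ‖f‖ ≤ finrank ℂ F * K := by
  let e : 𝓢(E, ℂ) →ₗ[ℂ] Lp ℂ 2 (volume : Measure E) :=
    (SchwartzMap.toLpCLM ℂ ℂ 2 volume : 𝓢(E, ℂ) →L[ℂ] _).toLinearMap
  have hdense : DenseRange e :=
    SchwartzMap.denseRange_toLpCLM (E := E) (F := ℂ) (p := 2) ENNReal.ofNat_ne_top
  let u' : 𝓢(E, ℂ) →ₗ[ℂ] F := ⟨⟨fun ψ => u ψ, map_add u⟩, map_smul u⟩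
  have hext : ∀ ψ, u'.extendOfNorm e (ψ.toLp 2 volume) = u ψ := fun ψ =>
    LinearMap.extendOfNorm_eq hdense ⟨K, hu⟩ ψ
  have hnorm : ‖u'.extendOfNorm e‖ ≤ K := LinearMap.opNorm_extendOfNorm_le hdense hK hu
  obtain ⟨f, hf, hfT⟩ := exists_Lp_two_integral_smul_eq (u'.extendOfNorm e)
  refine ⟨f, ?_, hf.trans (by gcongr)⟩
  ext1 ψ
  rw [← hext, ← hfT, Lp.toTemperedDistribution_apply]
  refine integral_congr_ae ?_
  filter_upwards [ψ.coeFn_toLp 2 volume] with x hx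
  rw [hx]

theorem two_le_inv_one_sub_inv {p : ℝ≥0∞} (hp : p ≤ 2) : 2 ≤ (1 - p⁻¹)⁻¹ := by
  rw [ENNReal.le_inv_iff_le_inv, tsub_le_iff_right, ← ENNReal.inv_two_add_inv_two]
  gcongr

theorem eLpNorm_scaledWeight_smul_toLp_smulLeftCLM {T : ℝ} (hT : 0 ≤ T) (s : ℝ) (ψ : 𝓢(E, F)) :
    eLpNorm (fun ξ => scaledWeight T s ξ • (SchwartzMap.smulLeftCLM F
      (fun ξ : E => (scaledWeight T (-s) ξ : ℂ)) ψ).toLp 2 (volume : Measure E) ξ) 2 volume =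
      ‖ψ.toLp 2 (volume : Measure E)‖ₑ := by
  rw [Lp.enorm_def]
  refine eLpNorm_congr_ae ?_
  filter_upwards [(SchwartzMap.smulLeftCLM F (fun ξ : E =>
    (scaledWeight T (-s) ξ : ℂ)) ψ).coeFn_toLp 2 volume, ψ.coeFn_toLp 2 volume] with ξ hφ hψ
  rw [hφ, hψ, SchwartzMap.smulLeftCLM_apply_apply (scaledWeight_hasTemperateGrowth hT _),
    scaledWeight_neg hT, Complex.coe_smul, smul_inv_smul₀ (scaledWeight_pos hT s ξ).ne']

/-- Dual to the weighted bound for the Fourier transform `L² → L^q` with `q = p / (p - 1)`. -/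
theorem exists_smulLeftCLM_fourier_eq [Nontrivial E] {p : ℝ≥0∞} [hp1 : Fact (1 ≤ p)] (hp : p ≤ 2)
    {ρ : ℝ} (hρ : finrank ℝ E * ((p⁻¹).toReal - 1 / 2) ≤ ρ)
    (hρ' : p = 1 → finrank ℝ E * ((p⁻¹).toReal - 1 / 2) < ρ) :
    ∃ C : ℝ, 0 < C ∧ ∀ (g : Lp F p (volume : Measure E)) (T : ℝ), 0 < T →
      ∃ f : Lp F 2 (volume : Measure E),
        smulLeftCLM F (fun ξ => (scaledWeight T (-(ρ / 2)) ξ : ℂ)) (𝓕 (g : 𝓢'(E, F))) = f ∧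
          ‖f‖ ≤ C * T ^ (-(finrank ℝ E / 2 * ((p⁻¹).toReal - 1 / 2) : ℝ)) * ‖g‖ := by
  have hpinv : p⁻¹ ≤ 1 := ENNReal.inv_le_one.2 hp1.out
  have hconj : 1 / 2 - ((1 - p⁻¹)⁻¹⁻¹).toReal = (p⁻¹).toReal - 1 / 2 := by
    rw [inv_inv, ENNReal.toReal_sub_of_le hpinv ENNReal.one_ne_top, ENNReal.toReal_one]
    ring
  have htop : (1 - p⁻¹)⁻¹ = ⊤ → p = 1 := fun h => by
    rw [ENNReal.inv_eq_top, tsub_eq_zero_iff_le, ENNReal.one_le_inv] at h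
    exact le_antisymm h hp1.out
  obtain ⟨C, hC, hCΦ⟩ := IsFourierContraction.exists_eLpNorm_le_scaledWeight_smul
    (μ := (volume : Measure E)) (ν := (volume : Measure E)) (F := ℂ) (G := ℂ) (ρ := ρ)
    (two_le_inv_one_sub_inv hp) (by rwa [hconj]) (fun h => by rw [hconj]; exact hρ' (htop h))
  rw [hconj] at hCΦ
  refine ⟨(finrank ℂ F + 1) * C, by positivity, fun g T hT => ?_⟩
  set w : E → ℂ := fun ξ => (scaledWeight T (-(ρ / 2)) ξ : ℂ)
  set M : ℝ := C * T ^ (-(finrank ℝ E / 2 * ((p⁻¹).toReal - 1 / 2) : ℝ))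
  have : 0 < M := by positivity
  have hbound : ∀ ψ : 𝓢(E, ℂ), ‖smulLeftCLM F w (𝓕 (g : 𝓢'(E, F))) ψ‖ ≤
      M * ‖g‖ * ‖ψ.toLp 2 (volume : Measure E)‖ := fun ψ => by
    have hfourier := hCΦ _ isFourierContraction_fourierTransform
      ((SchwartzMap.smulLeftCLM ℂ w ψ).toLp 2 volume) T hT
    rw [eLpNorm_scaledWeight_smul_toLp_smulLeftCLM hT.le] at hfourier
    have hdual := enorm_toTemperedDistribution_apply_le g (𝓕 (SchwartzMap.smulLeftCLM ℂ w ψ))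
    rw [← eLpNorm_congr_ae ((𝓕 (SchwartzMap.smulLeftCLM ℂ w ψ)).coeFn_toLp 2 volume),
      ← SchwartzMap.toLp_fourier_eq] at hdual
    have h := hdual.trans (mul_le_mul_left hfourier _)
    simp only [← ofReal_norm] at h
    rw [← ENNReal.ofReal_mul (by positivity), ← ENNReal.ofReal_mul (by positivity),
      ENNReal.ofReal_le_ofReal_iff (by positivity), mul_right_comm] at h
    exact h
  obtain ⟨f, hf, hfn⟩ := exists_Lp_two_eq_of_norm_apply_le _ (by positivity) hbound
  refine ⟨f, hf, hfn.trans ?_⟩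
  calc finrank ℂ F * (M * ‖g‖) ≤ (finrank ℂ F + 1) * (M * ‖g‖) := by
        gcongr
        linarith
    _ = (finrank ℂ F + 1) * C * T ^ (-(finrank ℝ E / 2 * ((p⁻¹).toReal - 1 / 2) : ℝ)) * ‖g‖ := by
        ring

end

/-! ### Slowly varying functions -/

/-- `f` is bounded by `M` on `[0, ∞)` and its derivative there is bounded by `M / (1 + t)`: the
bounds of order zero and one in the class `𝒯{0}`, with a common constant. -/
structure SlowlyVarying {E : Type*} [NormedAddCommGroup E] [NormedSpace ℝ E] (M : ℝ) (f : ℝ → E) :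
    Prop where
  differentiableOn : DifferentiableOn ℝ f (Ici 0)
  norm_le : ∀ t, 0 ≤ t → ‖f t‖ ≤ M
  norm_derivWithin_le : ∀ t, 0 ≤ t → ‖derivWithin f (Ici 0) t‖ ≤ M / (1 + t)

namespace SlowlyVarying

variable {E G R : Type*} [NormedAddCommGroup E] [NormedSpace ℝ E] [NormedAddCommGroup G]
  [NormedSpace ℝ G] [NormedRing R] [NormedAlgebra ℝ R] {M N : ℝ} {f : ℝ → E}

theorem nonneg (hf : SlowlyVarying M f) : 0 ≤ M :=
  (norm_nonneg _).trans (hf.norm_le 0 le_rfl)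

theorem continuousOn (hf : SlowlyVarying M f) : ContinuousOn f (Ici 0) :=
  hf.differentiableOn.continuousOn

theorem hasDerivWithinAt (hf : SlowlyVarying M f) {t : ℝ} (ht : 0 ≤ t) :
    HasDerivWithinAt f (derivWithin f (Ici 0) t) (Ici 0) t :=
  (hf.differentiableOn t ht).hasDerivWithinAt

theorem of_hasDerivWithinAt {f' : ℝ → E}
    (hf : ∀ t, 0 ≤ t → HasDerivWithinAt f (f' t) (Ici 0) t ∧ ‖f t‖ ≤ M ∧ ‖f' t‖ ≤ M / (1 + t)) :
    SlowlyVarying M f where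
  differentiableOn t ht := (hf t ht).1.differentiableWithinAt
  norm_le t ht := (hf t ht).2.1
  norm_derivWithin_le t ht := by
    rw [(hf t ht).1.derivWithin (uniqueDiffOn_Ici 0 t ht)]
    exact (hf t ht).2.2

theorem mono (hf : SlowlyVarying M f) (hMN : M ≤ N) : SlowlyVarying N f where
  differentiableOn := hf.differentiableOn
  norm_le t ht := (hf.norm_le t ht).trans hMN
  norm_derivWithin_le t ht := (hf.norm_derivWithin_le t ht).trans (by gcongr)

theorem sum {ι : Type*} {s : Finset ι} {M : ι → ℝ} {f : ι → ℝ → E}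
    (hf : ∀ i ∈ s, SlowlyVarying (M i) (f i)) :
    SlowlyVarying (∑ i ∈ s, M i) fun t => ∑ i ∈ s, f i t := by
  refine of_hasDerivWithinAt fun t ht =>
    ⟨.fun_sum fun i hi => (hf i hi).hasDerivWithinAt ht,
      norm_sum_le_of_le s fun i hi => (hf i hi).norm_le t ht, ?_⟩
  rw [Finset.sum_div]
  exact norm_sum_le_of_le s fun i hi => (hf i hi).norm_derivWithin_le t ht

theorem clm_apply (L : E →L[ℝ] G) (hf : SlowlyVarying M f) :
    SlowlyVarying (‖L‖ * M) fun t => L (f t) := by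
  refine of_hasDerivWithinAt fun t ht =>
    ⟨L.hasFDerivAt.comp_hasDerivWithinAt t (hf.hasDerivWithinAt ht),
      L.le_opNorm_of_le (hf.norm_le t ht), ?_⟩
  rw [mul_div_assoc]
  exact L.le_opNorm_of_le (hf.norm_derivWithin_le t ht)

theorem mul {f g : ℝ → R} (hf : SlowlyVarying M f) (hg : SlowlyVarying N g) :
    SlowlyVarying (2 * M * N) fun t => f t * g t := by
  have hM := hf.nonneg
  have hN := hg.nonneg
  refine of_hasDerivWithinAt fun t ht =>
    ⟨(hf.hasDerivWithinAt ht).mul (hg.hasDerivWithinAt ht), ?_, ?_⟩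
  · refine (norm_mul_le_of_le (hf.norm_le t ht) (hg.norm_le t ht)).trans ?_
    nlinarith [mul_nonneg hM hN]
  · calc _ ≤ M / (1 + t) * N + M * (N / (1 + t)) := norm_add_le_of_le
          (norm_mul_le_of_le (hf.norm_derivWithin_le t ht) (hg.norm_le t ht))
          (norm_mul_le_of_le (hf.norm_le t ht) (hg.norm_derivWithin_le t ht))
      _ = 2 * M * N / (1 + t) := by ring

theorem mul_pow {f g : ℝ → R} (hf : SlowlyVarying M f) (hg : SlowlyVarying N g) (j : ℕ) :
    SlowlyVarying ((2 * N) ^ j * M) fun t => f t * g t ^ j := by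
  induction j with
  | zero => simpa using hf
  | succ j ih =>
    convert ih.mul hg using 1
    · ring
    · simp only [pow_succ, mul_assoc]

end SlowlyVarying

/-! ### Hypocoercivity -/

/-- Weights `ε_j = δ ^ (j (2m + 4 - j))`, decreasing for `j ≤ m + 1`. The exponent is concave in `j`
with second difference `-2`, so that `ε_{j+1}² = δ² ε_j ε_{j+2}`: products of neighbours at distance
two are absorbed with the small factor `δ`. -/
noncomputable def logConcaveWeight (δ : ℝ) (m j : ℕ) : ℝ :=
  δ ^ ((j : ℤ) * (2 * m + 4 - j))

section

variable {δ : ℝ} {m j : ℕ}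

theorem logConcaveWeight_zero : logConcaveWeight δ m 0 = 1 := by
  simp [logConcaveWeight]

theorem logConcaveWeight_pos (hδ : 0 < δ) (m j : ℕ) : 0 < logConcaveWeight δ m j :=
  zpow_pos hδ _

theorem logConcaveWeight_le (hδ0 : 0 < δ) (hδ1 : δ ≤ 1) {i : ℕ} (hij : i ≤ j) (hj : j ≤ m + 1) :
    logConcaveWeight δ m j ≤ logConcaveWeight δ m i := by
  refine zpow_le_zpow_right_of_le_one₀ hδ0 hδ1 ?_
  zify at hij hj
  nlinarith

theorem logConcaveWeight_succ_le_sq (hδ0 : 0 < δ) (hδ1 : δ ≤ 1) (hj : j ≤ m) :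
    logConcaveWeight δ m (j + 1) ≤ δ ^ 2 := by
  rw [← zpow_natCast δ 2]
  refine zpow_le_zpow_right_of_le_one₀ hδ0 hδ1 ?_
  zify at hj
  push_cast
  nlinarith

theorem logConcaveWeight_succ_sq (hδ : δ ≠ 0) :
    logConcaveWeight δ m (j + 1) ^ 2 =
      δ ^ 2 * (logConcaveWeight δ m j * logConcaveWeight δ m (j + 2)) := by
  simp only [logConcaveWeight]
  rw [← zpow_natCast, ← zpow_mul, ← zpow_natCast δ 2, ← zpow_add₀ hδ, ← zpow_add₀ hδ]
  push_cast
  ring_nf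

theorem weighted_mul_le_of_sq_eq {e₀ e₁ e₂ x y : ℝ} (hδ : 0 ≤ δ) (h₀ : 0 ≤ e₀) (h₂ : 0 ≤ e₂)
    (h : e₁ ^ 2 = δ ^ 2 * (e₀ * e₂)) :
    e₁ * (x * y) ≤ δ / 2 * (e₀ * x ^ 2 + e₂ * y ^ 2) := by
  refine (abs_le_of_sq_le_sq' ?_ (by positivity)).2
  calc (e₁ * (x * y)) ^ 2 = δ ^ 2 * ((e₀ * x ^ 2) * (e₂ * y ^ 2)) := by rw [mul_pow, h]; ring
    _ ≤ (δ / 2 * (e₀ * x ^ 2 + e₂ * y ^ 2)) ^ 2 := by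
      linarith [mul_nonneg (sq_nonneg δ) (sq_nonneg (e₀ * x ^ 2 - e₂ * y ^ 2))]

theorem weighted_mul_le_of_le_sq {w ρ e e' x y : ℝ} (hδ : 0 < δ) (hw : 0 ≤ w) (hwρ : w ≤ ρ)
    (he : 0 ≤ e) (hee' : e ≤ e') (heδ : e ≤ δ ^ 2) :
    w * e * (x * y) ≤ δ / 2 * (x ^ 2 + w * ρ * (e' * y ^ 2)) := by
  have hsq : 0 ≤ (δ * x - w * e * y) ^ 2 / δ := by positivity
  have hexpand : (δ * x - w * e * y) ^ 2 / δ =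
      δ * x ^ 2 - 2 * (w * e * (x * y)) + (w * e * y) ^ 2 / δ := by
    field_simp
    ring
  have hlast : (w * e * y) ^ 2 / δ ≤ w * ρ * δ * (e' * y ^ 2) := by
    have : 0 ≤ ρ := hw.trans hwρ
    have : 0 ≤ e' := he.trans hee'
    rw [div_le_iff₀ hδ]
    calc (w * e * y) ^ 2 = w * w * (e * e) * y ^ 2 := by ring
      _ ≤ w * ρ * (δ ^ 2 * e') * y ^ 2 := by gcongr
      _ = _ := by ring
  linarith

/-- The sum `∑ ε_j b_j²` over `j ≤ m`, where `b_j` stands for `‖B A ^ j V‖`. -/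
noncomputable def weightedSqSum (δ : ℝ) (m : ℕ) (b : ℕ → ℝ) : ℝ :=
  ∑ j ∈ Finset.range (m + 1), logConcaveWeight δ m j * b j ^ 2

variable {b : ℕ → ℝ} {N c w ρ v : ℝ}

theorem logConcaveWeight_mul_sq_nonneg (hδ : 0 < δ) (j : ℕ) :
    0 ≤ logConcaveWeight δ m j * b j ^ 2 :=
  mul_nonneg (logConcaveWeight_pos hδ m j).le (sq_nonneg _)

theorem weightedSqSum_nonneg (hδ : 0 < δ) : 0 ≤ weightedSqSum δ m b :=
  Finset.sum_nonneg fun j _ => logConcaveWeight_mul_sq_nonneg hδ j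

theorem mul_sq_le_weightedSqSum (hδ0 : 0 < δ) (hδ1 : δ ≤ 1)
    (hK : c * v ^ 2 ≤ ∑ j ∈ Finset.range (m + 1), b j ^ 2) :
    logConcaveWeight δ m m * (c * v ^ 2) ≤ weightedSqSum δ m b := by
  refine (mul_le_mul_of_nonneg_left hK (logConcaveWeight_pos hδ0 m m).le).trans ?_
  rw [Finset.mul_sum]
  refine Finset.sum_le_sum fun j hj => mul_le_mul_of_nonneg_right ?_ (sq_nonneg _)
  exact logConcaveWeight_le hδ0 hδ1 (Finset.mem_range_succ_iff.1 hj) m.le_succ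

theorem sum_logConcaveWeight_le (hδ : 0 < δ) :
    ∑ j ∈ Finset.range m, logConcaveWeight δ m j * b j ^ 2 ≤ weightedSqSum δ m b := by
  rw [weightedSqSum, Finset.sum_range_succ]
  linarith [logConcaveWeight_mul_sq_nonneg (m := m) (b := b) hδ m]

theorem sum_logConcaveWeight_succ :
    ∑ j ∈ Finset.range m, logConcaveWeight δ m (j + 1) * b (j + 1) ^ 2 =
      weightedSqSum δ m b - b 0 ^ 2 := by
  rw [weightedSqSum, Finset.sum_range_succ', logConcaveWeight_zero]
  ring

theorem sum_logConcaveWeight_add_two_le (hδ0 : 0 < δ) (hδ1 : δ ≤ 1) (hc : 0 < c)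
    (hbv : b (m + 1) ^ 2 ≤ (N * v) ^ 2)
    (hK : c * v ^ 2 ≤ ∑ j ∈ Finset.range (m + 1), b j ^ 2) :
    ∑ j ∈ Finset.range m, logConcaveWeight δ m (j + 2) * b (j + 2) ^ 2 ≤
      (1 + N ^ 2 / c) * weightedSqSum δ m b := by
  have hlast : logConcaveWeight δ m (m + 1) * b (m + 1) ^ 2 ≤ N ^ 2 / c * weightedSqSum δ m b :=
    calc _ ≤ logConcaveWeight δ m m * (N * v) ^ 2 :=
          mul_le_mul (logConcaveWeight_le hδ0 hδ1 m.le_succ le_rfl) hbv (sq_nonneg _)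
            (logConcaveWeight_pos hδ0 m m).le
      _ = N ^ 2 / c * (logConcaveWeight δ m m * (c * v ^ 2)) := by field_simp
      _ ≤ _ := mul_le_mul_of_nonneg_left (mul_sq_le_weightedSqSum hδ0 hδ1 hK) (by positivity)
  have hshift : (∑ j ∈ Finset.range m, logConcaveWeight δ m (j + 2) * b (j + 2) ^ 2) +
      logConcaveWeight δ m 1 * b 1 ^ 2 =
      weightedSqSum δ m b - b 0 ^ 2 + logConcaveWeight δ m (m + 1) * b (m + 1) ^ 2 := by
    rw [← sum_logConcaveWeight_succ, ← Finset.sum_range_succ, Finset.sum_range_succ']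
  linarith [logConcaveWeight_mul_sq_nonneg (m := m) (b := b) hδ0 1, sq_nonneg (b 0)]

theorem corrector_term_le (hN : 0 ≤ N) (hδ0 : 0 < δ) (hδ1 : δ ≤ 1) (hw : 0 ≤ w) (hwρ : w ≤ ρ)
    (hj : j < m) :
    w * (logConcaveWeight δ m (j + 1) *
        (-ρ * b (j + 1) ^ 2 + ρ * (b j * b (j + 2)) + N * b 0 * (b (j + 1) + b j))) ≤
      N * δ * b 0 ^ 2 - w * ρ * (logConcaveWeight δ m (j + 1) * b (j + 1) ^ 2) +
        w * ρ * (δ / 2) * (logConcaveWeight δ m j * b j ^ 2 +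
          logConcaveWeight δ m (j + 2) * b (j + 2) ^ 2) +
        w * ρ * (N * δ / 2) * (logConcaveWeight δ m (j + 1) * b (j + 1) ^ 2 +
          logConcaveWeight δ m j * b j ^ 2) := by
  have hε := logConcaveWeight_pos hδ0 m
  have hsmall := logConcaveWeight_succ_le_sq hδ0 hδ1 hj.le
  have hneighbours := mul_le_mul_of_nonneg_left
    (weighted_mul_le_of_sq_eq (x := b j) (y := b (j + 2)) hδ0.le (hε j).le (hε (j + 2)).le
      (logConcaveWeight_succ_sq hδ0.ne'))
    (mul_nonneg hw (hw.trans hwρ))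
  have hfirst := mul_le_mul_of_nonneg_left
    (weighted_mul_le_of_le_sq (x := b 0) (y := b (j + 1)) hδ0 hw hwρ (hε (j + 1)).le le_rfl hsmall)
    hN
  have hsecond := mul_le_mul_of_nonneg_left
    (weighted_mul_le_of_le_sq (x := b 0) (y := b j) hδ0 hw hwρ (hε (j + 1)).le
      (logConcaveWeight_le hδ0 hδ1 j.le_succ (by omega)) hsmall) hN
  linarith

theorem sum_corrector_le (hN : 0 ≤ N) (hc : 0 < c) (hδ0 : 0 < δ) (hδ1 : δ ≤ 1)
    (hδm : δ * (m * N) ≤ 1) (hδc : δ * (1 + N ^ 2 / (2 * c) + N) ≤ 1 / 2) (hw : 0 ≤ w)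
    (hwρ : w ≤ ρ) (hwρ1 : w * ρ ≤ 1) (hbv : b (m + 1) ^ 2 ≤ (N * v) ^ 2)
    (hK : c * v ^ 2 ≤ ∑ j ∈ Finset.range (m + 1), b j ^ 2) :
    -2 * b 0 ^ 2 + w * ∑ j ∈ Finset.range m, logConcaveWeight δ m (j + 1) *
        (-ρ * b (j + 1) ^ 2 + ρ * (b j * b (j + 2)) + N * b 0 * (b (j + 1) + b j)) ≤
      -(logConcaveWeight δ m m * c / 2) * (w * ρ) * v ^ 2 := by
  set S := weightedSqSum δ m b
  have hκ : 0 ≤ w * ρ := mul_nonneg hw (hw.trans hwρ)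
  have hS : 0 ≤ w * ρ * S := mul_nonneg hκ (weightedSqSum_nonneg hδ0)
  have hterms := Finset.sum_le_sum fun j (hj : j ∈ Finset.range m) =>
    corrector_term_le (b := b) hN hδ0 hδ1 hw hwρ (Finset.mem_range.1 hj)
  simp only [← Finset.mul_sum, Finset.sum_add_distrib, Finset.sum_sub_distrib, Finset.sum_const,
    Finset.card_range, nsmul_eq_mul, sum_logConcaveWeight_succ] at hterms
  have hsums := mul_le_mul_of_nonneg_left (add_le_add
    (sum_logConcaveWeight_le (b := b) (m := m) hδ0)
    (sum_logConcaveWeight_add_two_le hδ0 hδ1 hc hbv hK)) (mul_nonneg hκ (half_pos hδ0).le)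
  have hsums' := mul_le_mul_of_nonneg_left (add_le_add (sub_le_self S (sq_nonneg (b 0)))
    (sum_logConcaveWeight_le (b := b) (m := m) hδ0))
    (mul_nonneg hκ (by positivity : (0 : ℝ) ≤ N * δ / 2))
  have hkalman := mul_le_mul_of_nonneg_left (mul_sq_le_weightedSqSum hδ0 hδ1 hK) hκ
  have habsorb := mul_le_mul_of_nonneg_right hδc hS
  have hcross : w * ρ * (δ / 2) * (S + (1 + N ^ 2 / c) * S) + w * ρ * (N * δ / 2) * (S + S) =
      δ * (1 + N ^ 2 / (2 * c) + N) * (w * ρ * S) := by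
    field_simp
    ring
  linarith [mul_le_mul_of_nonneg_right hδm (sq_nonneg (b 0)),
    mul_le_mul_of_nonneg_right hwρ1 (sq_nonneg (b 0))]

theorem exists_forall_sum_corrector_le (m : ℕ) (hN : 0 ≤ N) (hc : 0 < c) :
    ∃ δ η : ℝ, 0 < δ ∧ 0 < η ∧
      (∑ j ∈ Finset.range m, logConcaveWeight δ m (j + 1)) * N ^ 2 ≤ 1 / 2 ∧
      ∀ (w ρ v : ℝ) (b : ℕ → ℝ), 0 ≤ w → w ≤ ρ → w * ρ ≤ 1 → b (m + 1) ^ 2 ≤ (N * v) ^ 2 →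
        c * v ^ 2 ≤ ∑ j ∈ Finset.range (m + 1), b j ^ 2 →
        -2 * b 0 ^ 2 + w * ∑ j ∈ Finset.range m, logConcaveWeight δ m (j + 1) *
            (-ρ * b (j + 1) ^ 2 + ρ * (b j * b (j + 2)) + N * b 0 * (b (j + 1) + b j)) ≤
          -η * (w * ρ) * v ^ 2 := by
  set Q : ℝ := 1 + m * N + 2 * (1 + N ^ 2 / (2 * c) + N) + 2 * m * N ^ 2
  have hQ0 : 0 < Q := by positivity
  have hle {x : ℝ} (hx : x ≤ Q) : Q⁻¹ * x ≤ 1 := inv_mul_le_one_of_le₀ hx hQ0.le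
  have hmN : 0 ≤ m * N := by positivity
  have hNc : 0 ≤ 1 + N ^ 2 / (2 * c) + N := by positivity
  have hmN2 : 0 ≤ m * N ^ 2 := by positivity
  have hδ0 : 0 < Q⁻¹ := inv_pos.2 hQ0
  have hδ1 : Q⁻¹ ≤ 1 := by simpa using hle (x := 1) (by linarith)
  refine ⟨Q⁻¹, logConcaveWeight Q⁻¹ m m * c / 2, hδ0,
    by have := logConcaveWeight_pos hδ0 m m; positivity, ?_, fun w ρ v b hw hwρ hwρ1 hbv hK =>
      sum_corrector_le hN hc hδ0 hδ1 (hle (by linarith)) ?_ hw hwρ hwρ1 hbv hK⟩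
  · have hsum : ∑ j ∈ Finset.range m, logConcaveWeight Q⁻¹ m (j + 1) ≤ m * Q⁻¹ := by
      have hterm : ∀ j ∈ Finset.range m, logConcaveWeight Q⁻¹ m (j + 1) ≤ Q⁻¹ := fun j hj =>
        (logConcaveWeight_succ_le_sq hδ0 hδ1 (Finset.mem_range.1 hj).le).trans
          (pow_le_of_le_one hδ0.le hδ1 two_ne_zero)
      simpa using Finset.sum_le_card_nsmul _ _ _ hterm
    have := hle (x := 2 * m * N ^ 2) (by linarith)
    linarith [mul_le_mul_of_nonneg_right hsum (sq_nonneg N)]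
  · have := hle (x := 2 * (1 + N ^ 2 / (2 * c) + N)) (by linarith)
    linarith

end

section

variable {H : Type*} [NormedAddCommGroup H] [InnerProductSpace ℂ H]

theorem norm_sq_le_mul_re_inner {M : ℝ} {T : H →L[ℂ] H} (hT : T.IsPositive) (hTM : ‖T‖ ≤ M)
    (x : H) : ‖T x‖ ^ 2 ≤ M * (inner ℂ x (T x)).re := by
  rcases (norm_nonneg T).eq_or_lt with hT0 | hT0
  · have hTx : T x = 0 := by rw [norm_eq_zero.1 hT0.symm, zero_apply]
    simp [hTx]
  have hM : 0 < M := hT0.trans_le hTM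
  have hpos : 0 ≤ (inner ℂ ((M : ℂ) • x - T x) (T ((M : ℂ) • x - T x))).re :=
    hT.re_inner_nonneg_right _
  have hself : (inner ℂ (T x) (T x)).re = ‖T x‖ ^ 2 := inner_self_eq_norm_sq (𝕜 := ℂ) (T x)
  have hsymm : inner ℂ x (T (T x)) = inner ℂ (T x) (T x) := (hT.isSymmetric x (T x)).symm
  have hlast : (inner ℂ (T x) (T (T x))).re ≤ M * ‖T x‖ ^ 2 :=
    calc _ ≤ ‖T x‖ * ‖T (T x)‖ := re_inner_le_norm (𝕜 := ℂ) _ _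
      _ ≤ ‖T x‖ * (M * ‖T x‖) := by gcongr; exact T.le_of_opNorm_le hTM _
      _ = _ := by ring
  simp only [map_sub, map_smul, inner_sub_left, inner_sub_right, inner_smul_left, inner_smul_right,
    Complex.conj_ofReal, Complex.sub_re, Complex.re_ofReal_mul, hsymm, hself] at hpos
  refine le_of_mul_le_mul_left ?_ hM
  linarith

theorem im_inner_le_norm_mul_norm (x y : H) : (inner ℂ x y).im ≤ ‖x‖ * ‖y‖ :=
  (le_abs_self _).trans ((Complex.abs_im_le_norm _).trans (norm_inner_le_norm x y))

theorem hasDerivWithinAt_clm_apply {P : ℝ → H →L[ℂ] H} {P' : H →L[ℂ] H} {V : ℝ → H} {V' : H}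
    {s : Set ℝ} {t : ℝ} (hP : HasDerivWithinAt P P' s t) (hV : HasDerivWithinAt V V' s t) :
    HasDerivWithinAt (fun τ => P τ (V τ)) (P' (V t) + P t V') s t :=
  ((ContinuousLinearMap.restrictScalarsL ℂ H H ℝ ℝ).hasFDerivAt.comp_hasDerivWithinAt t
    hP).clm_apply hV

variable {A B : H →L[ℂ] H} {P Q : ℝ → H →L[ℂ] H} {V : ℝ → H} {N ρ t : ℝ}

theorem hasDerivWithinAt_norm_sq_of_isSymmetric (hA : (A : H →ₗ[ℂ] H).IsSymmetric)
    (hV : HasDerivWithinAt V (((ρ : ℂ) * Complex.I) • A (V t) - B (V t)) (Ici 0) t) :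
    HasDerivWithinAt (fun s => ‖V s‖ ^ 2) (-2 * (inner ℂ (V t) (B (V t))).re) (Ici 0) t := by
  have hsq : (fun s => ‖V s‖ ^ 2) = fun s => (inner ℂ (V s) (V s)).re :=
    funext fun s => (inner_self_eq_norm_sq (𝕜 := ℂ) (V s)).symm
  have hAim : (inner ℂ (V t) (A (V t))).im = 0 := hA.im_inner_self_apply (V t)
  rw [hsq]
  refine (Complex.reCLM.hasFDerivAt.comp_hasDerivWithinAt t (hV.inner ℂ hV)).congr_deriv ?_
  rw [Complex.reCLM_apply, Complex.add_re, ← inner_conj_symm _ (V t), Complex.conj_re,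
    inner_sub_right, inner_smul_right, Complex.sub_re, mul_assoc, Complex.re_ofReal_mul,
    Complex.I_mul_re, hAim]
  ring

/-- Here `p, q, r` stand for `P V`, `P A V`, `P A² V`, where `P` depends on time, `p', q'` for the
terms in which `P`, `P A` are differentiated, and `pb, qb` for `P B V`, `P A B V`. The good term
`-ρ ‖q‖ ^ 2` arises because `A` is moved onto the other factor of the inner product. -/
theorem im_inner_add_im_inner_le (hρ : 0 ≤ ρ) (p q r p' q' pb qb : H) :
    (inner ℂ p (q' + (((ρ : ℂ) * Complex.I) • r - qb))).im +
        (inner ℂ (p' + (((ρ : ℂ) * Complex.I) • q - pb)) q).im ≤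
      -ρ * ‖q‖ ^ 2 + ρ * (‖p‖ * ‖r‖) + (‖p‖ * ‖qb‖ + ‖pb‖ * ‖q‖) +
        (‖p‖ * ‖q'‖ + ‖p'‖ * ‖q‖) := by
  have hpr : (inner ℂ p (((ρ : ℂ) * Complex.I) • r)).im ≤ ρ * (‖p‖ * ‖r‖) := by
    refine (im_inner_le_norm_mul_norm _ _).trans_eq ?_
    rw [norm_smul, norm_mul, Complex.norm_I, Complex.norm_of_nonneg hρ]
    ring
  have hqq : (inner ℂ (((ρ : ℂ) * Complex.I) • q) q).im = -ρ * ‖q‖ ^ 2 := by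
    rw [inner_smul_left, inner_self_eq_norm_sq_to_K]
    simp [← Complex.ofReal_pow]
  have hpqb := im_inner_le_norm_mul_norm p (-qb)
  have hpbq := im_inner_le_norm_mul_norm (-pb) q
  rw [norm_neg] at hpqb hpbq
  simp only [sub_eq_add_neg, inner_add_right, inner_add_left, Complex.add_im, hqq]
  linarith [im_inner_le_norm_mul_norm p q', im_inner_le_norm_mul_norm p' q]

theorem exists_hasDerivWithinAt_im_inner (hP : SlowlyVarying N P) (hQ : SlowlyVarying N Q)
    (hPA : P t * A = Q t) (hρ : 0 ≤ ρ) (ht : 0 ≤ t)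
    (hV : HasDerivWithinAt V (((ρ : ℂ) * Complex.I) • A (V t) - B (V t)) (Ici 0) t) :
    ∃ D, HasDerivWithinAt (fun s => (inner ℂ (P s (V s)) (Q s (V s))).im) D (Ici 0) t ∧
      D ≤ (-ρ * ‖Q t (V t)‖ ^ 2 + ρ * (‖P t (V t)‖ * ‖(Q t * A) (V t)‖) +
          N * ‖B (V t)‖ * (‖Q t (V t)‖ + ‖P t (V t)‖)) + 2 * N ^ 2 / (1 + t) * ‖V t‖ ^ 2 := by
  have hN := hP.nonneg
  refine ⟨_, Complex.imCLM.hasFDerivAt.comp_hasDerivWithinAt t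
    ((hasDerivWithinAt_clm_apply (hP.hasDerivWithinAt ht) hV).inner ℂ
      (hasDerivWithinAt_clm_apply (hQ.hasDerivWithinAt ht) hV)), ?_⟩
  have hmap (T : H →L[ℂ] H) : T (((ρ : ℂ) * Complex.I) • A (V t) - B (V t)) =
      ((ρ : ℂ) * Complex.I) • (T * A) (V t) - T (B (V t)) := by
    rw [map_sub, map_smul, mul_apply_eq_comp]
  rw [Complex.imCLM_apply, Complex.add_im, hmap, hmap, hPA]
  refine (im_inner_add_im_inner_le hρ _ _ _ _ _ _ _).trans ?_
  have hPV := (P t).le_of_opNorm_le (hP.norm_le t ht) (V t)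
  have hQV := (Q t).le_of_opNorm_le (hQ.norm_le t ht) (V t)
  have hdamping : ‖P t (V t)‖ * ‖Q t (B (V t))‖ + ‖P t (B (V t))‖ * ‖Q t (V t)‖ ≤
      ‖P t (V t)‖ * (N * ‖B (V t)‖) + N * ‖B (V t)‖ * ‖Q t (V t)‖ := by
    gcongr
    · exact (Q t).le_of_opNorm_le (hQ.norm_le t ht) _
    · exact (P t).le_of_opNorm_le (hP.norm_le t ht) _
  have htime := add_le_add
    (mul_le_mul hPV ((derivWithin Q (Ici 0) t).le_of_opNorm_le (hQ.norm_derivWithin_le t ht) (V t))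
      (norm_nonneg _) (by positivity))
    (mul_le_mul ((derivWithin P (Ici 0) t).le_of_opNorm_le (hP.norm_derivWithin_le t ht) (V t)) hQV
      (norm_nonneg _) (by positivity))
  have hcombine : N * ‖V t‖ * (N / (1 + t) * ‖V t‖) + N / (1 + t) * ‖V t‖ * (N * ‖V t‖) =
      2 * N ^ 2 / (1 + t) * ‖V t‖ ^ 2 := by ring
  linarith

end

theorem le_mul_exp_of_deriv_le {f f' : ℝ → ℝ} {a k : ℝ} (hf : ContinuousOn f (Ici a))
    (hf' : ∀ t, a ≤ t → HasDerivWithinAt f (f' t) (Ici t) t) (hle : ∀ t, a ≤ t → f' t ≤ k * f t)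
    {t : ℝ} (ht : a ≤ t) : f t ≤ f a * Real.exp (k * (t - a)) := by
  rw [← gronwallBound_ε0]
  refine le_gronwallBound_of_liminf_deriv_right_le (hf.mono Icc_subset_Ici_self)
    (fun x hx r hr => (hf' x hx.1).liminf_right_slope_le hr) le_rfl (fun x hx => ?_) t
    (right_mem_Icc.2 ht)
  rw [add_zero]
  exact hle x hx.1

/-- The coefficients of an equation `V' = i ρ A(t) V - B(t) V` on a Hilbert space, with `A(t)`
symmetric and `B(t)` positive. All bounds are in terms of `M`, so that estimates for such families
are uniform in the Hilbert space. -/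
structure DissipativeFamily {H : Type*} [NormedAddCommGroup H] [InnerProductSpace ℂ H] (M : ℝ)
    (A B : ℝ → H →L[ℂ] H) : Prop where
  slowlyVarying_left : SlowlyVarying M A
  slowlyVarying_right : SlowlyVarying M B
  isSymmetric : ∀ t, 0 ≤ t → (A t : H →ₗ[ℂ] H).IsSymmetric
  isPositive : ∀ t, 0 ≤ t → (B t).IsPositive

/-- `V` solves `V' = i ρ A(t) V - B(t) V` on `[0, ∞)`, with one-sided derivative at `0`. -/
def IsDissipativeSolution {H : Type*} [NormedAddCommGroup H] [InnerProductSpace ℂ H] (ρ : ℝ)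
    (A B : ℝ → H →L[ℂ] H) (V : ℝ → H) : Prop :=
  ∀ t, 0 ≤ t → HasDerivWithinAt V (((ρ : ℂ) * Complex.I) • A t (V t) - B t (V t)) (Ici 0) t

/-- The functional `M ‖V‖² + w ∑_{j < m} ε_{j+1} Im ⟪B A ^ j V, B A ^ (j + 1) V⟫`, equivalent to
`‖V‖²`, whose derivative controls all the components `B A ^ j V`. -/
noncomputable def lyapunov {H : Type*} [NormedAddCommGroup H] [InnerProductSpace ℂ H] (m : ℕ)
    (M δ w : ℝ) (A B : ℝ → H →L[ℂ] H) (V : ℝ → H) (t : ℝ) : ℝ :=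
  M * ‖V t‖ ^ 2 + w * ∑ j ∈ Finset.range m, logConcaveWeight δ m (j + 1) *
    (inner ℂ ((B t * A t ^ j) (V t)) ((B t * A t ^ (j + 1)) (V t))).im

namespace DissipativeFamily

variable {H : Type*} [NormedAddCommGroup H] [InnerProductSpace ℂ H] {m : ℕ}
  {M δ w ρ c t t₀ : ℝ} {A B : ℝ → H →L[ℂ] H} {V : ℝ → H}

theorem slowlyVarying_mul_pow (h : DissipativeFamily M A B) (hM : 1 ≤ M) {j k : ℕ} (hjk : j ≤ k) :
    SlowlyVarying ((2 * M) ^ k * M) fun t => B t * A t ^ j := by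
  refine (h.slowlyVarying_right.mul_pow h.slowlyVarying_left j).mono ?_
  gcongr
  linarith

theorem norm_mul_pow_apply_le (h : DissipativeFamily M A B) (hM : 1 ≤ M) {j k : ℕ} (hjk : j ≤ k)
    (ht : 0 ≤ t) (x : H) : ‖(B t * A t ^ j) x‖ ≤ (2 * M) ^ k * M * ‖x‖ :=
  ContinuousLinearMap.le_of_opNorm_le _ ((h.slowlyVarying_mul_pow hM hjk).norm_le t ht) x

theorem norm_le_norm_zero (h : DissipativeFamily M A B) (hV : IsDissipativeSolution ρ A B V)
    (ht : 0 ≤ t) : ‖V t‖ ≤ ‖V 0‖ := by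
  have hder (s : ℝ) (hs : 0 ≤ s) :=
    hasDerivWithinAt_norm_sq_of_isSymmetric (h.isSymmetric s hs) (hV s hs)
  have hanti : AntitoneOn (fun s => ‖V s‖ ^ 2) (Ici 0) := by
    refine antitoneOn_of_hasDerivWithinAt_nonpos (convex_Ici 0)
      (fun s hs => (hder s hs).continuousWithinAt)
      (fun s hs => (hder s (interior_subset hs)).mono interior_subset) fun s hs => ?_
    have : 0 ≤ (inner ℂ (V s) (B s (V s))).re :=
      (h.isPositive s (interior_subset hs)).re_inner_nonneg_right _
    linarith
  exact (sq_le_sq₀ (norm_nonneg _) (norm_nonneg _)).1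
    (hanti self_mem_Ici (mem_Ici.2 ht) ht)

theorem abs_lyapunov_sub_le (h : DissipativeFamily M A B) (hM : 1 ≤ M) (hδ : 0 < δ)
    (hδM : (∑ j ∈ Finset.range m, logConcaveWeight δ m (j + 1)) * ((2 * M) ^ (m + 1) * M) ^ 2 ≤
      1 / 2) (hw0 : 0 ≤ w) (hw1 : w ≤ 1) (ht : 0 ≤ t) :
    |lyapunov m M δ w A B V t - M * ‖V t‖ ^ 2| ≤ ‖V t‖ ^ 2 / 2 := by
  set N := (2 * M) ^ (m + 1) * M
  have hterm (j : ℕ) (hj : j ∈ Finset.range m) :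
      |logConcaveWeight δ m (j + 1) *
        (inner ℂ ((B t * A t ^ j) (V t)) ((B t * A t ^ (j + 1)) (V t))).im| ≤
        logConcaveWeight δ m (j + 1) * (N ^ 2 * ‖V t‖ ^ 2) := by
    have hj := Finset.mem_range.1 hj
    rw [abs_mul, abs_of_pos (logConcaveWeight_pos hδ m _)]
    refine mul_le_mul_of_nonneg_left ?_ (logConcaveWeight_pos hδ m _).le
    calc _ ≤ ‖(B t * A t ^ j) (V t)‖ * ‖(B t * A t ^ (j + 1)) (V t)‖ :=
          (Complex.abs_im_le_norm _).trans (norm_inner_le_norm _ _)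
      _ ≤ (N * ‖V t‖) * (N * ‖V t‖) :=
          mul_le_mul (h.norm_mul_pow_apply_le hM (by omega) ht _)
            (h.norm_mul_pow_apply_le hM (by omega) ht _) (norm_nonneg _) (by positivity)
      _ = _ := by ring
  rw [lyapunov, add_sub_cancel_left, abs_mul, abs_of_nonneg hw0]
  refine (mul_le_of_le_one_left (abs_nonneg _) hw1).trans
    ((Finset.abs_sum_le_sum_abs _ _).trans ((Finset.sum_le_sum hterm).trans ?_))
  rw [← Finset.sum_mul, ← mul_assoc]
  linarith [mul_le_mul_of_nonneg_right hδM (sq_nonneg ‖V t‖)]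

theorem exists_hasDerivWithinAt_lyapunov (h : DissipativeFamily M A B) (hM : 1 ≤ M) (hδ : 0 < δ)
    (hw : 0 ≤ w) (hρ : 0 ≤ ρ) (hV : IsDissipativeSolution ρ A B V) (ht : 0 ≤ t) :
    ∃ D, HasDerivWithinAt (lyapunov m M δ w A B V) D (Ici 0) t ∧
      D ≤ (-2 * ‖B t (V t)‖ ^ 2 + w * ∑ j ∈ Finset.range m, logConcaveWeight δ m (j + 1) *
          (-ρ * ‖(B t * A t ^ (j + 1)) (V t)‖ ^ 2 +
            ρ * (‖(B t * A t ^ j) (V t)‖ * ‖(B t * A t ^ (j + 2)) (V t)‖) +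
            (2 * M) ^ (m + 1) * M * ‖B t (V t)‖ *
              (‖(B t * A t ^ (j + 1)) (V t)‖ + ‖(B t * A t ^ j) (V t)‖))) +
        w * ((∑ j ∈ Finset.range m, logConcaveWeight δ m (j + 1)) *
          (2 * ((2 * M) ^ (m + 1) * M) ^ 2 / (1 + t) * ‖V t‖ ^ 2)) := by
  have hcorrector (j : ℕ) (hj : j < m) := exists_hasDerivWithinAt_im_inner
    (h.slowlyVarying_mul_pow (j := j) (k := m + 1) hM (by omega))
    (h.slowlyVarying_mul_pow (j := j + 1) (k := m + 1) hM (by omega))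
    (by rw [mul_assoc, ← pow_succ]) hρ ht (hV t ht)
  choose! D hD hDle using hcorrector
  refine ⟨_, ((hasDerivWithinAt_norm_sq_of_isSymmetric (h.isSymmetric t ht) (hV t ht)).const_mul
    M).add ((HasDerivWithinAt.fun_sum fun j hj =>
      (hD j (Finset.mem_range.1 hj)).const_mul _).const_mul w), ?_⟩
  have hdamping := norm_sq_le_mul_re_inner (h.isPositive t ht)
    (h.slowlyVarying_right.norm_le t ht) (V t)
  have hsum := mul_le_mul_of_nonneg_left (Finset.sum_le_sum fun j (hj : j ∈ Finset.range m) =>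
    mul_le_mul_of_nonneg_left (hDle j (Finset.mem_range.1 hj))
      (logConcaveWeight_pos hδ m (j + 1)).le) hw
  simp only [mul_assoc (B t) (A t ^ _) (A t), ← pow_succ] at hsum
  simp only [mul_add _ _ (_ / _ * _), Finset.sum_add_distrib, ← Finset.sum_mul] at hsum
  linarith

theorem norm_sq_le_two_mul_lyapunov (h : DissipativeFamily M A B) (hM : 1 ≤ M) (hδ : 0 < δ)
    (hδM : (∑ j ∈ Finset.range m, logConcaveWeight δ m (j + 1)) * ((2 * M) ^ (m + 1) * M) ^ 2 ≤
      1 / 2) (hw0 : 0 ≤ w) (hw1 : w ≤ 1) (ht : 0 ≤ t) :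
    ‖V t‖ ^ 2 ≤ 2 * lyapunov m M δ w A B V t := by
  have := (abs_le.1 (h.abs_lyapunov_sub_le (V := V) hM hδ hδM hw0 hw1 ht)).1
  linarith [mul_le_mul_of_nonneg_right hM (sq_nonneg ‖V t‖)]

theorem lyapunov_le_mul_norm_sq (h : DissipativeFamily M A B) (hM : 1 ≤ M) (hδ : 0 < δ)
    (hδM : (∑ j ∈ Finset.range m, logConcaveWeight δ m (j + 1)) * ((2 * M) ^ (m + 1) * M) ^ 2 ≤
      1 / 2) (hw0 : 0 ≤ w) (hw1 : w ≤ 1) (ht : 0 ≤ t) :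
    lyapunov m M δ w A B V t ≤ 2 * M * ‖V t‖ ^ 2 := by
  have := (abs_le.1 (h.abs_lyapunov_sub_le (V := V) hM hδ hδM hw0 hw1 ht)).2
  linarith [mul_le_mul_of_nonneg_right hM (sq_nonneg ‖V t‖), sq_nonneg ‖V t‖]

theorem norm_sq_le_of_deriv_lyapunov_le {k t₁ : ℝ} (h : DissipativeFamily M A B)
    (hV : IsDissipativeSolution ρ A B V) (hM : 1 ≤ M) (hδ : 0 < δ)
    (hδM : (∑ j ∈ Finset.range m, logConcaveWeight δ m (j + 1)) * ((2 * M) ^ (m + 1) * M) ^ 2 ≤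
      1 / 2) (hw0 : 0 ≤ w) (hw1 : w ≤ 1) (hk : 0 ≤ k) (ht₁ : 0 ≤ t₁)
    (hder : ∀ t, t₁ ≤ t → ∃ D, HasDerivWithinAt (lyapunov m M δ w A B V) D (Ici 0) t ∧
      D ≤ -k * lyapunov m M δ w A B V t) (ht : 0 ≤ t) :
    ‖V t‖ ^ 2 ≤ 4 * M * Real.exp (-k * (t - t₁)) * ‖V 0‖ ^ 2 := by
  have hanti {s : ℝ} (hs : 0 ≤ s) : ‖V s‖ ^ 2 ≤ ‖V 0‖ ^ 2 := by
    gcongr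
    exact h.norm_le_norm_zero hV hs
  rcases le_total t t₁ with htt₁ | htt₁
  · have hexp : 1 ≤ Real.exp (-k * (t - t₁)) := Real.one_le_exp (by nlinarith)
    refine (hanti ht).trans (le_mul_of_one_le_left (sq_nonneg _) ?_)
    nlinarith
  · choose! D hD hDle using hder
    have hdecay := le_mul_exp_of_deriv_le (f := lyapunov m M δ w A B V)
      (fun s hs => (hD s hs).continuousWithinAt.mono (Ici_subset_Ici.2 ht₁))
      (fun s hs => (hD s hs).mono (Ici_subset_Ici.2 (ht₁.trans hs))) hDle htt₁
    calc ‖V t‖ ^ 2 ≤ 2 * lyapunov m M δ w A B V t :=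
          h.norm_sq_le_two_mul_lyapunov hM hδ hδM hw0 hw1 ht
      _ ≤ 2 * (2 * M * ‖V 0‖ ^ 2 * Real.exp (-k * (t - t₁))) := by
          refine mul_le_mul_of_nonneg_left (hdecay.trans ?_) zero_le_two
          gcongr
          refine (h.lyapunov_le_mul_norm_sq hM hδ hδM hw0 hw1 ht₁).trans ?_
          gcongr 2 * M * ?_
          exact hanti ht₁
      _ = _ := by ring

theorem exists_forall_deriv_lyapunov_le (m : ℕ) (hM : 1 ≤ M) (hc : 0 < c) :
    ∃ δ η : ℝ, 0 < δ ∧ 0 < η ∧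
      (∑ j ∈ Finset.range m, logConcaveWeight δ m (j + 1)) * ((2 * M) ^ (m + 1) * M) ^ 2 ≤ 1 / 2 ∧
      ∀ {H : Type*} [NormedAddCommGroup H] [InnerProductSpace ℂ H] {A B : ℝ → H →L[ℂ] H}
        {V : ℝ → H} {w ρ t : ℝ}, DissipativeFamily M A B → IsDissipativeSolution ρ A B V →
        0 ≤ w → w ≤ 1 → w ≤ ρ → w * ρ ≤ 1 → 0 ≤ t → 2 ≤ η * ρ * (1 + t) →
        (∀ x, c * ‖x‖ ^ 2 ≤ ∑ j ∈ Finset.range (m + 1), ‖(B t * A t ^ j) x‖ ^ 2) →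
        ∃ D, HasDerivWithinAt (lyapunov m M δ w A B V) D (Ici 0) t ∧
          D ≤ -(η / (4 * M)) * (w * ρ) * lyapunov m M δ w A B V t := by
  obtain ⟨δ, η, hδ, hη, hδM, hform⟩ :=
    exists_forall_sum_corrector_le m (N := (2 * M) ^ (m + 1) * M) (by positivity) hc
  refine ⟨δ, η, hδ, hη, hδM, fun {H _ _ A B V w ρ t} h hV hw0 hw1 hwρ hwρ1 ht hηt hK => ?_⟩
  have hρ : 0 ≤ ρ := hw0.trans hwρ
  obtain ⟨D, hD, hDle⟩ := h.exists_hasDerivWithinAt_lyapunov (m := m) hM hδ hw0 hρ hV ht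
  refine ⟨D, hD, hDle.trans ?_⟩
  have hmain := hform w ρ ‖V t‖ (fun j => ‖(B t * A t ^ j) (V t)‖) hw0 hwρ hwρ1
    (by gcongr; exact h.norm_mul_pow_apply_le hM le_rfl ht (V t)) (hK (V t))
  simp only [pow_zero, mul_one] at hmain
  have herror : w * ((∑ j ∈ Finset.range m, logConcaveWeight δ m (j + 1)) *
      (2 * ((2 * M) ^ (m + 1) * M) ^ 2 / (1 + t) * ‖V t‖ ^ 2)) ≤ η / 2 * (w * ρ) * ‖V t‖ ^ 2 := by
    have hinv : 1 / (1 + t) ≤ η * ρ / 2 := by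
      rw [div_le_iff₀ (by positivity)]
      linarith
    calc _ = w * (2 * ((∑ j ∈ Finset.range m, logConcaveWeight δ m (j + 1)) *
          ((2 * M) ^ (m + 1) * M) ^ 2) * (1 / (1 + t))) * ‖V t‖ ^ 2 := by ring
      _ ≤ w * (2 * (1 / 2) * (η * ρ / 2)) * ‖V t‖ ^ 2 := by gcongr
      _ = _ := by ring
  have hupper : η / (4 * M) * (w * ρ) * lyapunov m M δ w A B V t ≤
      η / 2 * (w * ρ) * ‖V t‖ ^ 2 :=
    calc _ ≤ η / (4 * M) * (w * ρ) * (2 * M * ‖V t‖ ^ 2) := mul_le_mul_of_nonneg_left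
          (h.lyapunov_le_mul_norm_sq hM hδ hδM hw0 hw1 ht) (by positivity)
      _ = _ := by field_simp; ring
  linarith

/-- For low frequencies `ρ` the corrector only pays off after a time of order `1 / ρ`; the loss up
to then is a constant factor, as the decay rate is of order `ρ²`. -/
theorem exists_norm_sq_le_exp (m : ℕ) (hM : 1 ≤ M) (hc : 0 < c) (ht₀ : 0 ≤ t₀) :
    ∃ C γ : ℝ, 0 < C ∧ 0 < γ ∧ ∀ {H : Type*} [NormedAddCommGroup H] [InnerProductSpace ℂ H]
      {A B : ℝ → H →L[ℂ] H} {V : ℝ → H} {ρ t : ℝ}, DissipativeFamily M A B →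
      (∀ t, t₀ ≤ t → ∀ x, c * ‖x‖ ^ 2 ≤
        ∑ j ∈ Finset.range (m + 1), ‖(B t * A t ^ j) x‖ ^ 2) →
      0 < ρ → IsDissipativeSolution ρ A B V → 0 ≤ t →
      ‖V t‖ ^ 2 ≤ C * Real.exp (-γ * (ρ ^ 2 / (1 + ρ ^ 2)) * t) * ‖V 0‖ ^ 2 := by
  obtain ⟨δ, η, hδ, hη, hδM, hlyapunov⟩ := exists_forall_deriv_lyapunov_le m hM hc
  have : 0 < M := one_pos.trans_le hM
  set γ := η / (4 * M)
  have hγ : 0 < γ := by positivity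
  refine ⟨4 * M * Real.exp (γ * (t₀ + 2 / η)), γ, by positivity, hγ,
    fun {H _ _ A B V ρ t} h hK hρ hV ht => ?_⟩
  set w := ρ / (1 + ρ ^ 2)
  have hw0 : 0 ≤ w := by positivity
  have hw1 : w ≤ 1 := (div_le_one (by positivity)).2 (by nlinarith [sq_nonneg (ρ - 1)])
  have hwρ : w ≤ ρ := div_le_self hρ.le (by nlinarith)
  have hκ : w * ρ = ρ ^ 2 / (1 + ρ ^ 2) := by ring
  have hκ1 : w * ρ ≤ 1 := hκ ▸ (div_le_one (by positivity)).2 (by linarith)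
  have hdelay : w * ρ * (t₀ + 2 / (η * ρ)) ≤ t₀ + 2 / η := by
    calc w * ρ * (t₀ + 2 / (η * ρ)) = w * ρ * t₀ + w * (2 / η) := by field_simp
      _ ≤ 1 * t₀ + 1 * (2 / η) := by gcongr
      _ = _ := by ring
  have hdecay := norm_sq_le_of_deriv_lyapunov_le (t₁ := t₀ + 2 / (η * ρ)) (k := γ * (w * ρ)) h hV
    hM hδ hδM hw0 hw1 (by positivity) (by positivity) (fun s hs => ?_) ht
  · refine hdecay.trans ?_
    rw [mul_assoc (4 * M) (Real.exp (γ * _)), ← Real.exp_add, ← hκ]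
    gcongr
    linarith [mul_le_mul_of_nonneg_left hdelay hγ.le]
  · have hs₀ : t₀ ≤ s := (le_add_of_nonneg_right (by positivity)).trans hs
    have hs₁ : 2 / (η * ρ) ≤ s := (le_add_of_nonneg_left ht₀).trans hs
    rw [div_le_iff₀' (by positivity)] at hs₁
    rw [← neg_mul]
    exact hlyapunov h hV hw0 hw1 hwρ hκ1 (ht₀.trans hs₀) (by nlinarith [mul_pos hη hρ]) (hK s hs₀)

end DissipativeFamily

/-! ### The coefficients -/

theorem TClass.exists_slowlyVarying {f : ℝ → ℂ} (hf : TClass 0 f) : ∃ M, SlowlyVarying M f := by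
  obtain ⟨C₀, hC₀⟩ := hf.2 0
  obtain ⟨C₁, hC₁⟩ := hf.2 1
  simp only [iteratedDerivWithin_zero, add_zero, pow_zero, mul_one] at hC₀
  simp only [iteratedDerivWithin_one, zero_add, pow_one, mul_one_div] at hC₁
  refine ⟨max C₀ C₁, hf.1.differentiableOn (by simp),
    fun t ht => (hC₀ t ht).trans (le_max_left _ _), fun t ht => (hC₁ t ht).trans ?_⟩
  gcongr
  exact le_max_right _ _

theorem exists_slowlyVarying_toEuclideanCLM {ι : Type*} [Fintype ι] [DecidableEq ι]
    {K : ℝ → Matrix ι ι ℂ} (hK : ∀ i j, ∃ M, SlowlyVarying M fun t => K t i j) :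
    ∃ M, SlowlyVarying M fun t => Matrix.toEuclideanCLM (𝕜 := ℂ) (K t) := by
  choose M hM using hK
  let singleCLM (i j : ι) : ℂ →L[ℝ] EuclideanSpace ℂ ι →L[ℂ] EuclideanSpace ℂ ι :=
    (ContinuousLinearMap.toSpanSingleton ℂ
      (Matrix.toEuclideanCLM (𝕜 := ℂ) (Matrix.single i j 1))).restrictScalars ℝ
  have hsum : (fun t => Matrix.toEuclideanCLM (𝕜 := ℂ) (K t)) =
      fun t => ∑ i, ∑ j, singleCLM i j (K t i j) := by
    ext1 t
    conv_lhs => rw [Matrix.matrix_eq_sum_single (K t)]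
    simp only [map_sum]
    refine Finset.sum_congr rfl fun i _ => Finset.sum_congr rfl fun j _ => ?_
    change _ = K t i j • Matrix.toEuclideanCLM (𝕜 := ℂ) (Matrix.single i j (1 : ℂ))
    rw [← map_smul, Matrix.smul_single, smul_eq_mul, mul_one]
  rw [hsum]
  exact ⟨_, .sum fun i _ => .sum fun j _ => (hM i j).clm_apply (singleCLM i j)⟩

section

variable {n d : ℕ} {A : Fin n → ℝ → Matrix (Fin d) (Fin d) ℂ} {B : ℝ → Matrix (Fin d) (Fin d) ℂ}

theorem symbolA_smul (A : Fin n → ℝ → Matrix (Fin d) (Fin d) ℂ) (t a : ℝ) (ξ : Rn n) :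
    symbolA A t (a • ξ) = (a : ℂ) • symbolA A t ξ := by
  simp only [symbolA, Finset.smul_sum, smul_smul, PiLp.smul_apply, smul_eq_mul, Complex.ofReal_mul]

theorem isHermitian_symbolA {t : ℝ} (hA : ∀ k, (A k t).IsHermitian) (ξ : Rn n) :
    (symbolA A t ξ).IsHermitian := by
  simp only [Matrix.IsHermitian, symbolA, Matrix.conjTranspose_sum, Matrix.conjTranspose_smul,
    (hA _).eq, RCLike.star_def, Complex.conj_ofReal]

/-- The uniform Kalman rank condition, for large times: the observability matrix with the blocks
`B(t) A(t, ξ) ^ j`, `j < m`, is bounded below on the unit sphere. -/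
def UniformKalman (m : ℕ) (A : Fin n → ℝ → Matrix (Fin d) (Fin d) ℂ)
    (B : ℝ → Matrix (Fin d) (Fin d) ℂ) : Prop :=
  ∃ c > 0, ∃ t₀ ≥ 0, ∀ t ≥ t₀, ∀ ξ : Rn n, ‖ξ‖ = 1 → ∀ v : Cd d,
    c * ‖v‖ ^ 2 ≤
      ∑ j ∈ Finset.range m, ‖Matrix.toEuclideanCLM (𝕜 := ℂ) (B t * symbolA A t ξ ^ j) v‖ ^ 2

theorem CondB3.uniformKalman (h : CondB3 A B) : UniformKalman d A B := by
  obtain ⟨c, hc, t₀, ht₀, hK⟩ := h (fun _ => 1) fun _ => one_pos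
  refine ⟨1 / c, by positivity, t₀, ht₀, fun t ht ξ hξ v => (hK t ht ξ hξ v).1.trans_eq ?_⟩
  simp only [one_mul]
  exact Fin.sum_univ_eq_sum_range
    (fun j => ‖Matrix.toEuclideanCLM (𝕜 := ℂ) (B t * symbolA A t ξ ^ j) v‖ ^ 2) d

theorem norm_mul_symbolA_pow_le_of_one_le_norm (K : Matrix (Fin d) (Fin d) ℂ) (t : ℝ) {ξ : Rn n}
    (hξ : 1 ≤ ‖ξ‖) (j : ℕ) (v : Cd d) :
    ‖Matrix.toEuclideanCLM (𝕜 := ℂ) (K * symbolA A t (‖ξ‖⁻¹ • ξ) ^ j) v‖ ≤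
      ‖Matrix.toEuclideanCLM (𝕜 := ℂ) (K * symbolA A t ξ ^ j) v‖ := by
  have hpolar : symbolA A t ξ = (‖ξ‖ : ℂ) • symbolA A t (‖ξ‖⁻¹ • ξ) := by
    rw [← symbolA_smul, smul_inv_smul₀ (by linarith)]
  rw [hpolar, smul_pow, mul_smul_comm, map_smul, smul_apply, norm_smul, norm_pow,
    Complex.norm_real, norm_norm]
  exact le_mul_of_one_le_left (norm_nonneg _) (one_le_pow₀ hξ)

theorem UniformKalman.exists_of_one_le_norm {m : ℕ} (h : UniformKalman m A B) :
    ∃ c > 0, ∃ t₀ ≥ 0, ∀ t ≥ t₀, ∀ ξ : Rn n, 1 ≤ ‖ξ‖ → ∀ v : Cd d,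
      c * ‖v‖ ^ 2 ≤
        ∑ j ∈ Finset.range m, ‖Matrix.toEuclideanCLM (𝕜 := ℂ) (B t * symbolA A t ξ ^ j) v‖ ^ 2 := by
  obtain ⟨c, hc, t₀, ht₀, hK⟩ := h
  refine ⟨c, hc, t₀, ht₀, fun t ht ξ hξ v => ?_⟩
  have hunit : ‖‖ξ‖⁻¹ • ξ‖ = 1 := norm_smul_inv_norm (𝕜 := ℝ) (norm_pos_iff.1 (by linarith))
  refine (hK t ht _ hunit v).trans (Finset.sum_le_sum fun j _ => ?_)
  gcongr
  exact norm_mul_symbolA_pow_le_of_one_le_norm (B t) t hξ j v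

end

/-! ### Operators of pointwise multiplication -/

section

variable {α F : Type*} [MeasurableSpace α] {μ : Measure α}

section

variable [NormedAddCommGroup F] [NormedSpace ℂ F]

/-- The action of a bounded operator on the values of an `L²` function. -/
noncomputable def compOp (μ : Measure α) (F : Type*) [NormedAddCommGroup F] [NormedSpace ℂ F] :
    (F →L[ℂ] F) →L[ℂ] Lp F 2 μ →L[ℂ] Lp F 2 μ :=
  (ContinuousLinearMap.id ℂ (F →L[ℂ] F)).compLpL₂ 2 μ

theorem norm_compOp_le : ‖compOp μ F‖ ≤ 1 :=
  ContinuousLinearMap.opNorm_le_bound _ zero_le_one fun K =>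
    ContinuousLinearMap.opNorm_le_bound _ (by positivity) fun f => by
      rw [one_mul]
      exact K.norm_compLp_le f

/-- Multiplication of an `L²` function by a bounded scalar function. -/
noncomputable def smulOp (F : Type*) [NormedAddCommGroup F] [NormedSpace ℂ F] (φ : Lp ℂ ∞ μ) :
    Lp F 2 μ →L[ℂ] Lp F 2 μ :=
  (ContinuousLinearMap.lsmul ℂ ℂ : ℂ →L[ℂ] F →L[ℂ] F).holderL μ ∞ 2 2 φ

theorem norm_smulOp_le (φ : Lp ℂ ∞ μ) : ‖smulOp F φ‖ ≤ ‖φ‖ := by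
  refine ContinuousLinearMap.opNorm_le_bound _ (norm_nonneg _) fun f => ?_
  refine ((ContinuousLinearMap.lsmul ℂ ℂ : ℂ →L[ℂ] F →L[ℂ] F).norm_holder_apply_apply_le
    φ f).trans ?_
  gcongr
  exact mul_le_of_le_one_left (norm_nonneg _) ContinuousLinearMap.opNorm_lsmul_le

/-- `T` is the operator on `L²` of pointwise multiplication by the operator-valued function `m`. -/
def IsMultiplicationBy (T : Lp F 2 μ →L[ℂ] Lp F 2 μ) (m : α → F →L[ℂ] F) : Prop :=
  ∀ f : Lp F 2 μ, ∀ᵐ x ∂μ, T f x = m x (f x)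

theorem isMultiplicationBy_compOp (K : F →L[ℂ] F) : IsMultiplicationBy (compOp μ F K) fun _ => K :=
  K.coeFn_compLpL

theorem isMultiplicationBy_smulOp (φ : Lp ℂ ∞ μ) :
    IsMultiplicationBy (smulOp F φ) fun x => φ x • 1 :=
  (ContinuousLinearMap.lsmul ℂ ℂ : ℂ →L[ℂ] F →L[ℂ] F).coeFn_holder φ

namespace IsMultiplicationBy

variable {S T : Lp F 2 μ →L[ℂ] Lp F 2 μ} {m m' : α → F →L[ℂ] F}

theorem congr (hT : IsMultiplicationBy T m) (hm : m =ᵐ[μ] m') : IsMultiplicationBy T m' := by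
  intro f
  filter_upwards [hT f, hm] with x hTx hmx
  rw [hTx, hmx]

theorem mul (hS : IsMultiplicationBy S m) (hT : IsMultiplicationBy T m') :
    IsMultiplicationBy (S * T) fun x => m x * m' x := by
  intro f
  filter_upwards [hS (T f), hT f] with x hSx hTx
  rw [mul_apply_eq_comp, hSx, hTx, mul_apply_eq_comp]

theorem pow (hT : IsMultiplicationBy T m) (j : ℕ) :
    IsMultiplicationBy (T ^ j) fun x => m x ^ j := by
  induction j with
  | zero => exact fun f => by simp
  | succ j ih => simpa only [pow_succ] using ih.mul hT

theorem sum {ι : Type*} {s : Finset ι} {T : ι → Lp F 2 μ →L[ℂ] Lp F 2 μ} {m : ι → α → F →L[ℂ] F}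
    (hT : ∀ i ∈ s, IsMultiplicationBy (T i) (m i)) :
    IsMultiplicationBy (∑ i ∈ s, T i) fun x => ∑ i ∈ s, m i x := by
  intro f
  have hTs : ∀ᵐ x ∂μ, ∀ i ∈ s, T i f x = m i x (f x) :=
    (ae_ball_iff s.countable_toSet).2 fun i hi => hT i hi f
  rw [sum_apply]
  filter_upwards [Lp.coeFn_finsetSum s fun i => T i f, hTs] with x hsum hTx
  rw [hsum, Finset.sum_apply, sum_apply]
  exact Finset.sum_congr rfl hTx

end IsMultiplicationBy

end

theorem integrable_norm_sq [NormedAddCommGroup F] (f : Lp F 2 μ) :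
    Integrable (fun x => ‖f x‖ ^ 2) μ :=
  (Lp.memLp f).integrable_norm_pow two_ne_zero

variable [NormedAddCommGroup F] [InnerProductSpace ℂ F]

theorem norm_sq_eq_integral_norm_sq (f : Lp F 2 μ) : ‖f‖ ^ 2 = ∫ x, ‖f x‖ ^ 2 ∂μ := by
  rw [← inner_self_eq_norm_sq (𝕜 := ℂ) f, L2.inner_def, ← integral_re (L2.integrable_inner f f)]
  exact integral_congr_ae (Eventually.of_forall fun x => inner_self_eq_norm_sq (𝕜 := ℂ) (f x))

namespace IsMultiplicationBy

variable {T : Lp F 2 μ →L[ℂ] Lp F 2 μ} {m : α → F →L[ℂ] F}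

theorem isSymmetric (hT : IsMultiplicationBy T m)
    (hm : ∀ᵐ x ∂μ, (m x : F →ₗ[ℂ] F).IsSymmetric) : (T : Lp F 2 μ →ₗ[ℂ] Lp F 2 μ).IsSymmetric := by
  intro f g
  rw [ContinuousLinearMap.coe_coe, L2.inner_def, L2.inner_def]
  refine integral_congr_ae ?_
  filter_upwards [hT f, hT g, hm] with x hf hg hmx
  rw [hf, hg]
  exact hmx (f x) (g x)

theorem isPositive (hT : IsMultiplicationBy T m) (hm : ∀ᵐ x ∂μ, (m x).IsPositive) :
    T.IsPositive := by
  refine ⟨hT.isSymmetric (hm.mono fun _ hmx => hmx.1), fun f => ?_⟩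
  rw [ContinuousLinearMap.reApplyInnerSelf_apply, L2.inner_def,
    ← integral_re (L2.integrable_inner (T f) f)]
  refine integral_nonneg_of_ae ?_
  filter_upwards [hT f, hm] with x hf hmx
  rw [Pi.zero_apply, hf]
  exact hmx.2 (f x)

theorem mul_norm_sq_le_sum {ι : Type*} {s : Finset ι} {T : ι → Lp F 2 μ →L[ℂ] Lp F 2 μ}
    {m : ι → α → F →L[ℂ] F} {c : ℝ} (hT : ∀ i ∈ s, IsMultiplicationBy (T i) (m i))
    (hc : ∀ᵐ x ∂μ, ∀ v, c * ‖v‖ ^ 2 ≤ ∑ i ∈ s, ‖m i x v‖ ^ 2) (f : Lp F 2 μ) :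
    c * ‖f‖ ^ 2 ≤ ∑ i ∈ s, ‖T i f‖ ^ 2 := by
  simp_rw [norm_sq_eq_integral_norm_sq]
  rw [← integral_const_mul, ← integral_finsetSum _ fun i _ => integrable_norm_sq _]
  refine integral_mono_ae ((integrable_norm_sq _).const_mul c)
    (integrable_finsetSum _ fun i _ => integrable_norm_sq _) ?_
  have hTs : ∀ᵐ x ∂μ, ∀ i ∈ s, T i f x = m i x (f x) :=
    (ae_ball_iff s.countable_toSet).2 fun i hi => hT i hi f
  filter_upwards [hTs, hc] with x hTx hcx
  exact (hcx (f x)).trans_eq (Finset.sum_congr rfl fun i hi => by rw [hTx i hi])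

end IsMultiplicationBy

end

/-! ### The equation on an annulus -/

/-- The annulus `σ < |ξ| < 2σ` in frequency space. On it the equation is an ordinary differential
equation whose coefficients, rescaled by `σ`, are bounded independently of `σ`. -/
def annulus (n : ℕ) (σ : ℝ) : Set (Rn n) := {ξ | σ < ‖ξ‖ ∧ ‖ξ‖ < 2 * σ}

theorem isOpen_annulus (n : ℕ) (σ : ℝ) : IsOpen (annulus n σ) :=
  (isOpen_lt continuous_const continuous_norm).inter (isOpen_lt continuous_norm continuous_const)

theorem ae_mem_annulus (n : ℕ) (σ : ℝ) : ∀ᵐ ξ ∂volume.restrict (annulus n σ), ξ ∈ annulus n σ :=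
  ae_restrict_mem (isOpen_annulus n σ).measurableSet

section

variable {n d : ℕ} {σ : ℝ} (hσ : 0 < σ) {A : Fin n → ℝ → Matrix (Fin d) (Fin d) ℂ}
  {B : ℝ → Matrix (Fin d) (Fin d) ℂ} {t : ℝ}

include hσ in
theorem ae_norm_coord_le (k : Fin n) :
    ∀ᵐ ξ ∂volume.restrict (annulus n σ), ‖((σ⁻¹ * ξ k : ℝ) : ℂ)‖ ≤ 2 := by
  filter_upwards [ae_mem_annulus n σ] with ξ hξ
  rw [Complex.norm_real, norm_mul, norm_inv, Real.norm_of_nonneg hσ.le, inv_mul_le_iff₀ hσ,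
    mul_comm]
  exact (PiLp.norm_apply_le ξ k).trans hξ.2.le

include hσ in
theorem memLp_top_coord (k : Fin n) :
    MemLp (fun ξ : Rn n => ((σ⁻¹ * ξ k : ℝ) : ℂ)) ∞ (volume.restrict (annulus n σ)) :=
  memLp_top_of_bound (by fun_prop : Continuous fun ξ : Rn n =>
    ((σ⁻¹ * ξ k : ℝ) : ℂ)).aestronglyMeasurable 2 (ae_norm_coord_le hσ k)

/-- The coordinate `ξₖ / σ` as a bounded function on the annulus. -/
noncomputable def annulusCoord (k : Fin n) : Lp ℂ ∞ (volume.restrict (annulus n σ)) :=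
  (memLp_top_coord hσ k).toLp _

theorem norm_annulusCoord_le (k : Fin n) : ‖annulusCoord hσ k‖ ≤ 2 := by
  rw [annulusCoord, Lp.norm_toLp]
  refine ENNReal.toReal_le_of_le_ofReal (by norm_num) ?_
  rw [eLpNorm_exponent_top]
  exact eLpNormEssSup_le_of_ae_bound (ae_norm_coord_le hσ k)

/-- The operator of multiplication by `A(t, ξ / σ)` in `L²` of the annulus. -/
noncomputable def annulusA (A : Fin n → ℝ → Matrix (Fin d) (Fin d) ℂ) (t : ℝ) :
    Lp (Cd d) 2 (volume.restrict (annulus n σ)) →L[ℂ]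
      Lp (Cd d) 2 (volume.restrict (annulus n σ)) :=
  ∑ k, smulOp (Cd d) (annulusCoord hσ k) *
    compOp _ (Cd d) (Matrix.toEuclideanCLM (𝕜 := ℂ) (A k t))

/-- The operator of multiplication by `B(t)` in `L²` of the annulus. -/
noncomputable def annulusB (n : ℕ) (σ : ℝ) (B : ℝ → Matrix (Fin d) (Fin d) ℂ) (t : ℝ) :
    Lp (Cd d) 2 (volume.restrict (annulus n σ)) →L[ℂ]
      Lp (Cd d) 2 (volume.restrict (annulus n σ)) :=
  compOp _ (Cd d) (Matrix.toEuclideanCLM (𝕜 := ℂ) (B t))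

theorem isMultiplicationBy_annulusA : IsMultiplicationBy (annulusA hσ A t) fun ξ =>
    Matrix.toEuclideanCLM (𝕜 := ℂ) (symbolA A t (σ⁻¹ • ξ)) := by
  refine IsMultiplicationBy.congr (.sum fun k _ =>
    (isMultiplicationBy_smulOp _).mul (isMultiplicationBy_compOp _)) ?_
  have hcoord : ∀ᵐ ξ ∂volume.restrict (annulus n σ), ∀ k,
      annulusCoord hσ k ξ = ((σ⁻¹ * ξ k : ℝ) : ℂ) :=
    ae_all_iff.2 fun k => (memLp_top_coord hσ k).coeFn_toLp
  filter_upwards [hcoord] with ξ hξ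
  simp only [hξ, symbolA, map_sum, map_smul, smul_mul_assoc, one_mul, PiLp.smul_apply, smul_eq_mul]

theorem isMultiplicationBy_annulusB_mul_pow (j : ℕ) :
    IsMultiplicationBy (annulusB n σ B t * annulusA hσ A t ^ j) fun ξ =>
      Matrix.toEuclideanCLM (𝕜 := ℂ) (B t * symbolA A t (σ⁻¹ • ξ) ^ j) := by
  simp only [map_mul, map_pow]
  exact (isMultiplicationBy_compOp _).mul ((isMultiplicationBy_annulusA hσ).pow j)

theorem slowlyVarying_annulusA {M : Fin n → ℝ}
    (hA : ∀ k, SlowlyVarying (M k) fun t => Matrix.toEuclideanCLM (𝕜 := ℂ) (A k t)) :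
    SlowlyVarying (2 * ∑ k, M k) (annulusA hσ A) := by
  let L (k : Fin n) := ((ContinuousLinearMap.mul ℂ _ (smulOp (Cd d) (annulusCoord hσ k))).comp
    (compOp (volume.restrict (annulus n σ)) (Cd d))).restrictScalars ℝ
  have hL (k : Fin n) : ‖L k‖ ≤ 2 := by
    rw [ContinuousLinearMap.norm_restrictScalars]
    refine (ContinuousLinearMap.opNorm_comp_le _ _).trans ((mul_le_of_le_one_right
      (norm_nonneg _) norm_compOp_le).trans ?_)
    exact (ContinuousLinearMap.opNorm_mul_apply_le _ _ _).trans
      ((norm_smulOp_le _).trans (norm_annulusCoord_le hσ k))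
  refine (SlowlyVarying.sum fun k _ => (hA k).clm_apply (L k)).mono ?_
  rw [Finset.mul_sum]
  have hM (k : Fin n) : 0 ≤ M k := (hA k).nonneg
  gcongr with k
  exacts [hM k, hL k]

theorem slowlyVarying_annulusB {M : ℝ}
    (hB : SlowlyVarying M fun t => Matrix.toEuclideanCLM (𝕜 := ℂ) (B t)) :
    SlowlyVarying M (annulusB n σ B) := by
  refine (hB.clm_apply ((compOp _ (Cd d)).restrictScalars ℝ)).mono ?_
  rw [ContinuousLinearMap.norm_restrictScalars]
  exact mul_le_of_le_one_left hB.nonneg norm_compOp_le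

theorem exists_dissipativeFamily_annulus
    (hA : ∀ k, ∃ M, SlowlyVarying M fun t => Matrix.toEuclideanCLM (𝕜 := ℂ) (A k t))
    (hB : ∃ M, SlowlyVarying M fun t => Matrix.toEuclideanCLM (𝕜 := ℂ) (B t)) (hAB : CondB1 A B) :
    ∃ M : ℝ, 1 ≤ M ∧ ∀ {σ : ℝ} (hσ : 0 < σ),
      DissipativeFamily M (annulusA hσ A) (annulusB n σ B) := by
  choose MA hMA using hA
  obtain ⟨MB, hMB⟩ := hB
  refine ⟨max 1 (max (2 * ∑ k, MA k) MB), le_max_left _ _, fun hσ => ⟨?_, ?_, ?_, ?_⟩⟩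
  · exact (slowlyVarying_annulusA hσ hMA).mono ((le_max_left _ _).trans (le_max_right _ _))
  · exact (slowlyVarying_annulusB hMB).mono ((le_max_right _ _).trans (le_max_right _ _))
  · refine fun t ht => (isMultiplicationBy_annulusA hσ).isSymmetric (ae_of_all _ fun ξ => ?_)
    exact Matrix.isSymmetric_toEuclideanLin_iff.2 (isHermitian_symbolA (hAB t ht).1 _)
  · refine fun t ht => (isMultiplicationBy_compOp _).isPositive (ae_of_all _ fun _ => ?_)
    exact (Matrix.isPositive_toEuclideanLin_iff.2 (hAB t ht).2)

theorem mul_norm_sq_le_sum_annulus {c : ℝ} {m : ℕ}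
    (hK : ∀ ξ : Rn n, 1 ≤ ‖ξ‖ → ∀ v : Cd d, c * ‖v‖ ^ 2 ≤
      ∑ j ∈ Finset.range m, ‖Matrix.toEuclideanCLM (𝕜 := ℂ) (B t * symbolA A t ξ ^ j) v‖ ^ 2)
    (f : Lp (Cd d) 2 (volume.restrict (annulus n σ))) :
    c * ‖f‖ ^ 2 ≤
      ∑ j ∈ Finset.range m, ‖(annulusB n σ B t * annulusA hσ A t ^ j) f‖ ^ 2 := by
  refine IsMultiplicationBy.mul_norm_sq_le_sum
    (fun j _ => isMultiplicationBy_annulusB_mul_pow hσ j) ?_ f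
  filter_upwards [ae_mem_annulus n σ] with ξ hξ
  refine hK _ ?_
  rw [norm_smul, norm_inv, Real.norm_of_nonneg hσ.le, ← div_eq_inv_mul, one_le_div hσ]
  exact hξ.1.le

end

/-! ### The equation on the Fourier side -/

section

variable {E F : Type*} [NormedAddCommGroup E] [InnerProductSpace ℝ E] [FiniteDimensional ℝ E]
  [MeasurableSpace E] [BorelSpace E] [NormedAddCommGroup F] [InnerProductSpace ℂ F]

theorem integrable_schwartz_smul (ψ : 𝓢(E, ℂ)) (f : Lp F 2 (volume : Measure E)) :
    Integrable fun ξ => ψ ξ • f ξ :=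
  memLp_one_iff_integrable.1 ((Lp.memLp f).smul (ψ.memLp 2 volume))

theorem setIntegral_smul_LpToLpRestrictCLM_eq {Ω : Set E} {ψ : E → ℂ} (hψ : ∀ ξ ∉ Ω, ψ ξ = 0)
    (f : Lp F 2 (volume : Measure E)) :
    ∫ ξ in Ω, ψ ξ • LpToLpRestrictCLM E F ℂ volume 2 Ω f ξ = ∫ ξ, ψ ξ • f ξ := by
  rw [← setIntegral_eq_integral_of_forall_compl_eq_zero (s := Ω)
    (f := fun ξ => ψ ξ • f ξ) fun ξ hξ => by rw [hψ ξ hξ, zero_smul]]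
  refine integral_congr_ae ?_
  filter_upwards [LpToLpRestrictCLM_coeFn (s := Ω) (μ := volume) ℂ f] with ξ hξ
  rw [hξ]

variable [CompleteSpace F]

theorem toTemperedDistribution_apply_fourier (f : Lp F 2 (volume : Measure E)) (ψ : 𝓢(E, ℂ)) :
    (f : 𝓢'(E, F)) (𝓕 ψ) = ∫ ξ, ψ ξ • (𝓕 f : Lp F 2 (volume : Measure E)) ξ := by
  rw [← Lp.toTemperedDistribution_apply, ← Lp.fourier_toTemperedDistribution_eq]
  rfl

theorem lineDeriv_toTemperedDistribution_apply_fourier (f : Lp F 2 (volume : Measure E)) (e : E)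
    (ψ : 𝓢(E, ℂ)) :
    (∂_{e} (f : 𝓢'(E, F)) : 𝓢'(E, F)) (𝓕 ψ) = (2 * Real.pi * Complex.I) •
      ∫ ξ, SchwartzMap.smulLeftCLM ℂ (fun ξ : E => ((inner ℝ ξ e : ℝ) : ℂ)) ψ ξ •
        (𝓕 f : Lp F 2 (volume : Measure E)) ξ := by
  rw [← toTemperedDistribution_apply_fourier]
  exact congrArg (fun u : 𝓢'(E, F) => u ψ)
    (TemperedDistribution.fourier_lineDerivOp_eq (f : 𝓢'(E, F)) e)

theorem Lp_eq_zero_of_forall_setIntegral_schwartz_smul_eq_zero {Ω : Set E} (hΩ : IsOpen Ω)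
    {f : Lp F 2 (volume.restrict Ω)}
    (hf : ∀ ψ : 𝓢(E, ℂ), (∀ ξ ∉ Ω, ψ ξ = 0) → ∫ ξ in Ω, ψ ξ • f ξ = 0) : f = 0 := by
  have hae : ∀ᵐ ξ ∂volume.restrict Ω, ξ ∈ Ω → f ξ = 0 := by
    refine hΩ.ae_eq_zero_of_integral_contDiff_smul_eq_zero
      (((Lp.memLp f).locallyIntegrable (by norm_num)).locallyIntegrableOn _)
      fun g hg hgc hgΩ => ?_
    have hgcℂ : HasCompactSupport fun ξ => (g ξ : ℂ) :=
      hgc.comp_left (g := fun x : ℝ => (x : ℂ)) Complex.ofReal_zero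
    let ψ : 𝓢(E, ℂ) := hgcℂ.toSchwartzMap (Complex.ofRealCLM.contDiff.comp hg)
    have hψΩ : ∀ ξ ∉ Ω, ψ ξ = 0 := fun ξ hξ =>
      Complex.ofReal_eq_zero.2 (image_eq_zero_of_notMem_tsupport fun h => hξ (hgΩ h))
    refine .trans (integral_congr_ae (ae_of_all _ fun ξ => ?_)) (hf ψ hψΩ)
    exact (Complex.coe_smul (g ξ) (f ξ)).symm
  rw [Lp.eq_zero_iff_ae_eq_zero]
  filter_upwards [hae, ae_restrict_mem hΩ.measurableSet] with ξ hξ hξΩ using hξ hξΩ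

end

theorem exists_clm_eq_integral_smul {α F : Type*} [MeasurableSpace α] {μ : Measure α}
    [NormedAddCommGroup F] [NormedSpace ℂ F] [CompleteSpace F] {ψ : α → ℂ} (hψ : MemLp ψ 2 μ) :
    ∃ l : Lp F 2 μ →L[ℂ] F, ∀ f, l f = ∫ x, ψ x • f x ∂μ := by
  refine ⟨(ContinuousLinearMap.lsmul ℂ ℂ : ℂ →L[ℂ] F →L[ℂ] F).lpPairing μ 2 2 (hψ.toLp ψ),
    fun f => ?_⟩
  rw [ContinuousLinearMap.lpPairing_eq_integral]
  refine integral_congr_ae ?_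
  filter_upwards [hψ.coeFn_toLp] with x hx
  rw [hx, ContinuousLinearMap.lsmul_apply]

section

variable {H F : Type*} [NormedAddCommGroup H] [NormedSpace ℝ H] [NormedAddCommGroup F]
  [NormedSpace ℝ F]

theorem eqOn_Ici_of_hasDerivWithinAt_eq {f g f' : ℝ → F} {a : ℝ}
    (hf : ∀ t, a ≤ t → HasDerivWithinAt f (f' t) (Ici a) t)
    (hg : ∀ t, a ≤ t → HasDerivWithinAt g (f' t) (Ici a) t) (ha : f a = g a) :
    EqOn f g (Ici a) := by
  intro s hs
  have hcont : ContinuousOn f (Icc a s) := fun t ht =>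
    (hf t ht.1).continuousWithinAt.mono Icc_subset_Ici_self
  have hcont' : ContinuousOn g (Icc a s) := fun t ht =>
    (hg t ht.1).continuousWithinAt.mono Icc_subset_Ici_self
  exact eq_of_has_deriv_right_eq (fun t ht => (hf t ht.1).mono (Ici_subset_Ici.2 ht.1))
    (fun t ht => (hg t ht.1).mono (Ici_subset_Ici.2 ht.1)) hcont hcont' ha s (right_mem_Icc.2 hs)

theorem hasDerivWithinAt_of_forall_clm [CompleteSpace H] {ι : Type*} (l : ι → H →L[ℝ] F)
    (hl : ∀ x, (∀ i, l i x = 0) → x = 0) {X Z : ℝ → H} {a : ℝ} (hZ : ContinuousOn Z (Ici a))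
    (hX : ∀ i t, a ≤ t → HasDerivWithinAt (fun s => l i (X s)) (l i (Z t)) (Ici a) t) {t : ℝ}
    (ht : a ≤ t) : HasDerivWithinAt X (Z t) (Ici a) t := by
  let Zext (s : ℝ) : H := Z (max s a)
  have hZext : Continuous Zext := hZ.comp_continuous (by fun_prop) fun s => le_max_right s a
  let Y (s : ℝ) : H := X a + ∫ r in a..s, Zext r
  have hY (s : ℝ) (hs : a ≤ s) : HasDerivWithinAt Y (Z s) (Ici a) s := by
    have hderiv := (hZext.integral_hasStrictDerivAt a s).hasDerivAt.const_add (X a)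
    simp only [Zext, max_eq_left hs] at hderiv
    exact hderiv.hasDerivWithinAt
  have hXY : EqOn X Y (Ici a) := by
    intro s hs
    refine sub_eq_zero.1 (hl _ fun i => ?_)
    rw [map_sub, sub_eq_zero]
    exact eqOn_Ici_of_hasDerivWithinAt_eq (hX i)
      (fun r hr => (l i).hasFDerivAt.comp_hasDerivWithinAt r (hY r hr)) (by simp [Y]) hs
  exact (hY t ht).congr_of_mem hXY ht

end

section

variable {H F ι : Type*} [NormedAddCommGroup H] [InnerProductSpace ℂ H] [CompleteSpace H]
  [NormedAddCommGroup F] [NormedSpace ℂ F]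

theorem IsDissipativeSolution.of_forall_clm (l : ι → H →L[ℂ] F)
    (hl : ∀ x, (∀ i, l i x = 0) → x = 0) {ρ : ℝ} {A B : ℝ → H →L[ℂ] H} {V : ℝ → H}
    (hA : ContinuousOn A (Ici 0)) (hB : ContinuousOn B (Ici 0)) (hV : ContinuousOn V (Ici 0))
    (h : ∀ i t, 0 ≤ t → HasDerivWithinAt (fun s => l i (V s))
      (l i (((ρ : ℂ) * Complex.I) • A t (V t) - B t (V t))) (Ici 0) t) :
    IsDissipativeSolution ρ A B V := fun _ ht =>
  hasDerivWithinAt_of_forall_clm (fun i => (l i).restrictScalars ℝ) hl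
    (((hA.clm_apply hV).const_smul ((ρ : ℂ) * Complex.I)).sub (hB.clm_apply hV)) h ht

end

section

variable {n d : ℕ} {A : Fin n → ℝ → Matrix (Fin d) (Fin d) ℂ}
  {B : ℝ → Matrix (Fin d) (Fin d) ℂ} {U₀ : 𝓢'(Rn n, Cd d)}
  {U : ℝ → Lp (Cd d) 2 (volume : Measure (Rn n))} {σ : ℝ}

theorem smulLeftCLM_inner_single_apply (ψ : 𝓢(Rn n, ℂ)) (k : Fin n) (ξ : Rn n) :
    SchwartzMap.smulLeftCLM ℂ
      (fun ξ : Rn n => ((inner ℝ ξ (EuclideanSpace.single k 1) : ℝ) : ℂ)) ψ ξ = ξ k * ψ ξ := by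
  rw [SchwartzMap.smulLeftCLM_apply_apply (by fun_prop)]
  simp [EuclideanSpace.inner_single_right]

theorem integrable_schwartz_smul_coord_smul (ψ : 𝓢(Rn n, ℂ)) (k : Fin n)
    (f : Lp (Cd d) 2 (volume : Measure (Rn n))) :
    Integrable fun ξ => ψ ξ • (ξ k : ℂ) • f ξ := by
  refine (integrable_schwartz_smul (SchwartzMap.smulLeftCLM ℂ
    (fun ξ : Rn n => ((inner ℝ ξ (EuclideanSpace.single k 1) : ℝ) : ℂ)) ψ) f).congr
    (ae_of_all _ fun ξ => ?_)
  simp only [smulLeftCLM_inner_single_apply, mul_smul, smul_comm (ξ k : ℂ)]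

theorem lineDeriv_single_toTemperedDistribution_apply_fourier (k : Fin n)
    (f : Lp (Cd d) 2 (volume : Measure (Rn n))) (ψ : 𝓢(Rn n, ℂ)) :
    (∂_{EuclideanSpace.single k (1 : ℝ)} (f : 𝓢'(Rn n, Cd d)) : 𝓢'(Rn n, Cd d)) (𝓕 ψ) =
      (2 * Real.pi * Complex.I) •
        ∫ ξ, ψ ξ • (ξ k : ℂ) • (𝓕 f : Lp (Cd d) 2 (volume : Measure (Rn n))) ξ := by
  rw [lineDeriv_toTemperedDistribution_apply_fourier]
  simp only [smulLeftCLM_inner_single_apply, mul_smul, smul_comm (_ : ℂ) (ψ _)]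

theorem integral_smul_symbolA_sub_eq (ψ : 𝓢(Rn n, ℂ)) (t : ℝ) (z : ℂ)
    (f : Lp (Cd d) 2 (volume : Measure (Rn n))) :
    ∫ ξ, ψ ξ • (z • Matrix.toEuclideanCLM (𝕜 := ℂ) (symbolA A t ξ) (f ξ) -
        Matrix.toEuclideanCLM (𝕜 := ℂ) (B t) (f ξ)) =
      z • ∑ k, Matrix.toEuclideanCLM (𝕜 := ℂ) (A k t) (∫ ξ, ψ ξ • (ξ k : ℂ) • f ξ) -
        Matrix.toEuclideanCLM (𝕜 := ℂ) (B t) (∫ ξ, ψ ξ • f ξ) := by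
  have hpoint (ξ : Rn n) : ψ ξ • (z • Matrix.toEuclideanCLM (𝕜 := ℂ) (symbolA A t ξ) (f ξ) -
      Matrix.toEuclideanCLM (𝕜 := ℂ) (B t) (f ξ)) =
      z • ∑ k, Matrix.toEuclideanCLM (𝕜 := ℂ) (A k t) (ψ ξ • (ξ k : ℂ) • f ξ) -
        Matrix.toEuclideanCLM (𝕜 := ℂ) (B t) (ψ ξ • f ξ) := by
    simp only [symbolA, map_sum, map_smul, sum_apply, smul_apply, smul_sub, smul_comm (ψ ξ) z,
      Finset.smul_sum]
  have hA (k : Fin n) : Integrable fun ξ =>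
      Matrix.toEuclideanCLM (𝕜 := ℂ) (A k t) (ψ ξ • (ξ k : ℂ) • f ξ) :=
    ContinuousLinearMap.integrable_comp _ (integrable_schwartz_smul_coord_smul ψ k f)
  have hAsum : Integrable fun ξ =>
      z • ∑ k, Matrix.toEuclideanCLM (𝕜 := ℂ) (A k t) (ψ ξ • (ξ k : ℂ) • f ξ) :=
    (integrable_finsetSum _ fun k _ => hA k).smul z
  simp_rw [hpoint]
  rw [integral_sub hAsum
      (ContinuousLinearMap.integrable_comp _ (integrable_schwartz_smul ψ f)),
    integral_smul, integral_finsetSum _ fun k _ => hA k,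
    ContinuousLinearMap.integral_comp_comm _ (integrable_schwartz_smul ψ f)]
  simp_rw [ContinuousLinearMap.integral_comp_comm _ (integrable_schwartz_smul_coord_smul ψ _ f)]

theorem IsSolution.hasDerivWithinAt_integral (hU : IsSolution A B U₀ U) (ψ : 𝓢(Rn n, ℂ)) {t : ℝ}
    (ht : 0 ≤ t) :
    HasDerivWithinAt
      (fun s => ∫ ξ, ψ ξ • (𝓕 (U s) : Lp (Cd d) 2 (volume : Measure (Rn n))) ξ)
      (∫ ξ, ψ ξ • ((2 * Real.pi * Complex.I) • Matrix.toEuclideanCLM (𝕜 := ℂ) (symbolA A t ξ)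
            ((𝓕 (U t) : Lp (Cd d) 2 (volume : Measure (Rn n))) ξ) -
          Matrix.toEuclideanCLM (𝕜 := ℂ) (B t)
            ((𝓕 (U t) : Lp (Cd d) 2 (volume : Measure (Rn n))) ξ)))
      (Ici 0) t := by
  have hderiv := hU.equation (𝓕 ψ) t ht
  simp only [toTemperedDistribution_apply_fourier,
    lineDeriv_single_toTemperedDistribution_apply_fourier] at hderiv
  refine hderiv.congr_deriv ?_
  rw [integral_smul_symbolA_sub_eq, smul_add, smul_smul Complex.I Complex.I, Complex.I_mul_I,
    neg_one_smul, ← sub_eq_add_neg]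
  congr 1
  simp only [map_smul, smul_smul, ← Finset.smul_sum]
  congr 1
  linear_combination (-2 * Real.pi * Complex.I) * Complex.I_mul_I

/-- The Fourier transform of a solution, restricted to the annulus `σ < |ξ| < 2σ`. -/
noncomputable def annulusFourier (σ : ℝ) (U : ℝ → Lp (Cd d) 2 (volume : Measure (Rn n))) (t : ℝ) :
    Lp (Cd d) 2 (volume.restrict (annulus n σ)) :=
  LpToLpRestrictCLM (Rn n) (Cd d) ℂ volume 2 (annulus n σ) (𝓕 (U t))

theorem coeFn_annulusFourier (σ : ℝ) (U : ℝ → Lp (Cd d) 2 (volume : Measure (Rn n))) (t : ℝ) :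
    annulusFourier σ U t =ᵐ[volume.restrict (annulus n σ)]
      (𝓕 (U t) : Lp (Cd d) 2 (volume : Measure (Rn n))) :=
  LpToLpRestrictCLM_coeFn ℂ _ _

theorem continuousOn_annulusFourier {s : Set ℝ} (hU : ContinuousOn U s) :
    ContinuousOn (annulusFourier σ U) s :=
  ((LpToLpRestrictCLM (Rn n) (Cd d) ℂ volume 2 (annulus n σ)).continuous.comp
    (Lp.fourierTransformₗᵢ (Rn n) (Cd d)).continuous).comp_continuousOn hU

theorem ae_annulus_equation_eq (hσ : 0 < σ) (U : ℝ → Lp (Cd d) 2 (volume : Measure (Rn n)))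
    (t : ℝ) :
    ∀ᵐ ξ ∂volume.restrict (annulus n σ),
      ((((2 * Real.pi * σ : ℝ) : ℂ) * Complex.I) • annulusA hσ A t (annulusFourier σ U t) -
          annulusB n σ B t (annulusFourier σ U t)) ξ =
        (2 * Real.pi * Complex.I) • Matrix.toEuclideanCLM (𝕜 := ℂ) (symbolA A t ξ)
            ((𝓕 (U t) : Lp (Cd d) 2 (volume : Measure (Rn n))) ξ) -
          Matrix.toEuclideanCLM (𝕜 := ℂ) (B t)
            ((𝓕 (U t) : Lp (Cd d) 2 (volume : Measure (Rn n))) ξ) := by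
  let X := annulusFourier σ U t
  let ρI := ((2 * Real.pi * σ : ℝ) : ℂ) * Complex.I
  filter_upwards [coeFn_annulusFourier σ U t, isMultiplicationBy_annulusA hσ (A := A) (t := t) X,
    isMultiplicationBy_compOp (Matrix.toEuclideanCLM (𝕜 := ℂ) (B t)) X,
    Lp.coeFn_sub (ρI • annulusA hσ A t X) (annulusB n σ B t X),
    Lp.coeFn_smul ρI (annulusA hσ A t X)] with ξ hX hA hB hsub hsmul
  rw [hsub, Pi.sub_apply, hsmul, Pi.smul_apply, hA, annulusB, hB, hX, symbolA_smul, map_smul,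
    smul_apply, smul_smul]
  congr 2
  simp only [ρI]
  push_cast
  field_simp

theorem IsSolution.hasDerivWithinAt_setIntegral_annulus (hσ : 0 < σ) (hU : IsSolution A B U₀ U)
    {ψ : 𝓢(Rn n, ℂ)} (hψ : ∀ ξ ∉ annulus n σ, ψ ξ = 0) {t : ℝ} (ht : 0 ≤ t) :
    HasDerivWithinAt (fun s => ∫ ξ in annulus n σ, ψ ξ • annulusFourier σ U s ξ)
      (∫ ξ in annulus n σ, ψ ξ •
        ((((2 * Real.pi * σ : ℝ) : ℂ) * Complex.I) • annulusA hσ A t (annulusFourier σ U t) -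
          annulusB n σ B t (annulusFourier σ U t)) ξ)
      (Ici 0) t := by
  simp only [annulusFourier, setIntegral_smul_LpToLpRestrictCLM_eq hψ]
  refine (hU.hasDerivWithinAt_integral ψ ht).congr_deriv ?_
  rw [← setIntegral_eq_integral_of_forall_compl_eq_zero (s := annulus n σ)
    fun ξ hξ => by rw [hψ ξ hξ, zero_smul]]
  refine integral_congr_ae ?_
  filter_upwards [ae_annulus_equation_eq hσ U t (A := A) (B := B)] with ξ hξ
  exact congrArg (ψ ξ • ·) hξ.symm

theorem IsSolution.isDissipativeSolution_annulusFourier (hσ : 0 < σ) (hU : IsSolution A B U₀ U)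
    (hA : ContinuousOn (annulusA hσ A) (Ici 0)) (hB : ContinuousOn (annulusB n σ B) (Ici 0)) :
    IsDissipativeSolution (2 * Real.pi * σ) (annulusA hσ A) (annulusB n σ B)
      (annulusFourier σ U) := by
  choose l hl using fun ψ : {ψ : 𝓢(Rn n, ℂ) // ∀ ξ ∉ annulus n σ, ψ ξ = 0} =>
    exists_clm_eq_integral_smul (F := Cd d) ((ψ.1.memLp 2 volume).restrict (annulus n σ))
  refine IsDissipativeSolution.of_forall_clm l (fun f hf => ?_) hA hB
    (continuousOn_annulusFourier hU.continuousOn) (fun ψ t ht => ?_)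
  · exact Lp_eq_zero_of_forall_setIntegral_schwartz_smul_eq_zero (isOpen_annulus n σ)
      fun ψ hψ => (hl ⟨ψ, hψ⟩ f).symm.trans (hf ⟨ψ, hψ⟩)
  · simp only [hl]
    exact hU.hasDerivWithinAt_setIntegral_annulus hσ ψ.2 ht

end

/-! ### Pointwise decay of the Fourier transform -/

section

variable {α F : Type*} [MeasurableSpace α] {μ : Measure α} [NormedAddCommGroup F]

theorem IsMultiplicationBy.commute_smulOp [NormedSpace ℂ F] {T : Lp F 2 μ →L[ℂ] Lp F 2 μ}
    {m : α → F →L[ℂ] F} (hT : IsMultiplicationBy T m) (φ : Lp ℂ ∞ μ) :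
    Commute (smulOp F φ) T := by
  refine ContinuousLinearMap.ext fun f => Lp.ext ?_
  filter_upwards [(isMultiplicationBy_smulOp φ).mul hT f, hT.mul (isMultiplicationBy_smulOp φ) f]
    with x hφT hTφ
  rw [hφT, hTφ, smul_one_mul, mul_smul_one]

variable [InnerProductSpace ℂ F]

theorem norm_sq_smulOp_indicator {s : Set α} (hs : MeasurableSet s) (f : Lp F 2 μ) :
    ‖smulOp F (MemLp.toLp _ ((memLp_top_const (μ := μ) (1 : ℂ)).indicator hs)) f‖ ^ 2 =
      ∫ x in s, ‖f x‖ ^ 2 ∂μ := by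
  have hmem := (memLp_top_const (μ := μ) (1 : ℂ)).indicator hs
  rw [norm_sq_eq_integral_norm_sq, ← integral_indicator hs]
  refine integral_congr_ae ?_
  filter_upwards [isMultiplicationBy_smulOp (hmem.toLp _) f, hmem.coeFn_toLp] with x hsmul hind
  rw [hsmul, hind]
  by_cases hx : x ∈ s <;> simp [hx]

theorem ae_norm_sq_le_of_forall_norm_sq_smulOp_le {f g : Lp F 2 μ} {K : ℝ}
    (h : ∀ φ : Lp ℂ ∞ μ, ‖smulOp F φ f‖ ^ 2 ≤ K * ‖smulOp F φ g‖ ^ 2) :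
    ∀ᵐ x ∂μ, ‖f x‖ ^ 2 ≤ K * ‖g x‖ ^ 2 := by
  refine ae_le_of_forall_setIntegral_le (integrable_norm_sq f)
    ((integrable_norm_sq g).const_mul K) fun s hs _ => ?_
  rw [integral_const_mul, ← norm_sq_smulOp_indicator hs, ← norm_sq_smulOp_indicator hs]
  exact h _

end

theorem IsDissipativeSolution.clm_apply {H : Type*} [NormedAddCommGroup H] [InnerProductSpace ℂ H]
    {ρ : ℝ} {A B : ℝ → H →L[ℂ] H} {V : ℝ → H} (hV : IsDissipativeSolution ρ A B V)
    {L : H →L[ℂ] H} (hA : ∀ t, Commute L (A t)) (hB : ∀ t, Commute L (B t)) :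
    IsDissipativeSolution ρ A B fun t => L (V t) := by
  intro t ht
  have hderiv := (L.restrictScalars ℝ).hasFDerivAt.comp_hasDerivWithinAt t (hV t ht)
  have hcommA : L (A t (V t)) = A t (L (V t)) := DFunLike.congr_fun (hA t) (V t)
  have hcommB : L (B t (V t)) = B t (L (V t)) := DFunLike.congr_fun (hB t) (V t)
  rwa [ContinuousLinearMap.coe_restrictScalars', map_sub, map_smul, hcommA, hcommB] at hderiv

theorem DissipativeFamily.exists_ae_norm_sq_le_exp {M c t₀ : ℝ} (m : ℕ) (hM : 1 ≤ M) (hc : 0 < c)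
    (ht₀ : 0 ≤ t₀) :
    ∃ C γ : ℝ, 0 < C ∧ 0 < γ ∧ ∀ {α F : Type*} [MeasurableSpace α] {μ : Measure α}
      [NormedAddCommGroup F] [InnerProductSpace ℂ F] {A B : ℝ → Lp F 2 μ →L[ℂ] Lp F 2 μ}
      {V : ℝ → Lp F 2 μ} {ρ t : ℝ}, DissipativeFamily M A B →
      (∀ φ t, Commute (smulOp F φ) (A t)) → (∀ φ t, Commute (smulOp F φ) (B t)) →
      (∀ t, t₀ ≤ t → ∀ f, c * ‖f‖ ^ 2 ≤ ∑ j ∈ Finset.range (m + 1), ‖(B t * A t ^ j) f‖ ^ 2) →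
      0 < ρ → IsDissipativeSolution ρ A B V → 0 ≤ t →
      ∀ᵐ x ∂μ, ‖V t x‖ ^ 2 ≤ C * Real.exp (-γ * (ρ ^ 2 / (1 + ρ ^ 2)) * t) * ‖V 0 x‖ ^ 2 := by
  obtain ⟨C, γ, hC, hγ, hdecay⟩ := DissipativeFamily.exists_norm_sq_le_exp m hM hc ht₀
  refine ⟨C, γ, hC, hγ, fun {α F _ μ _ _ A B V ρ t} hAB hA hB hK hρ hV ht =>
    ae_norm_sq_le_of_forall_norm_sq_smulOp_le fun φ => ?_⟩
  exact hdecay (V := fun s => smulOp F φ (V s)) hAB hK hρ (hV.clm_apply (hA φ) (hB φ)) ht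

theorem sq_div_one_add_sq_le {x y : ℝ} (hx : 0 ≤ x) (hxy : x ≤ y) :
    x ^ 2 / (1 + x ^ 2) ≤ y ^ 2 / (1 + y ^ 2) := by
  rw [div_le_div_iff₀ (by positivity) (by positivity)]
  linarith [pow_le_pow_left₀ hx hxy 2]

theorem ae_exists_rat_mem_annulus {n : ℕ} (hn : 0 < n) :
    ∀ᵐ ξ : Rn n, ∃ a : {a : ℚ // 0 < a}, ξ ∈ annulus n (a : ℚ) := by
  have : Nonempty (Fin n) := ⟨⟨0, hn⟩⟩
  filter_upwards [Measure.ae_ne volume (0 : Rn n)] with ξ hξ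
  have hpos : 0 < ‖ξ‖ := norm_pos_iff.2 hξ
  obtain ⟨a, hξa, haξ⟩ := exists_rat_btwn (half_lt_self hpos)
  have ha : (0 : ℝ) < a := (half_pos hpos).trans hξa
  exact ⟨⟨a, Rat.cast_pos.1 ha⟩, haξ, by linarith⟩

section

variable {n d m : ℕ} {A : Fin n → ℝ → Matrix (Fin d) (Fin d) ℂ}
  {B : ℝ → Matrix (Fin d) (Fin d) ℂ}

theorem exists_ae_norm_sq_annulusFourier_le
    (hA : ∀ k, ∃ M, SlowlyVarying M fun t => Matrix.toEuclideanCLM (𝕜 := ℂ) (A k t))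
    (hB : ∃ M, SlowlyVarying M fun t => Matrix.toEuclideanCLM (𝕜 := ℂ) (B t))
    (hAB : CondB1 A B) (hK : UniformKalman m A B) :
    ∃ C γ : ℝ, 0 < C ∧ 0 < γ ∧ ∀ {U₀ : 𝓢'(Rn n, Cd d)}
      {U : ℝ → Lp (Cd d) 2 (volume : Measure (Rn n))}, IsSolution A B U₀ U →
      ∀ {σ t : ℝ}, 0 < σ → 0 ≤ t → ∀ᵐ ξ ∂volume.restrict (annulus n σ),
        ‖annulusFourier σ U t ξ‖ ^ 2 ≤
          C * Real.exp (-γ * ((2 * Real.pi * σ) ^ 2 / (1 + (2 * Real.pi * σ) ^ 2)) * t) *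
            ‖annulusFourier σ U 0 ξ‖ ^ 2 := by
  obtain ⟨M, hM, hfamily⟩ := exists_dissipativeFamily_annulus hA hB hAB
  obtain ⟨c, hc, t₀, ht₀, hlower⟩ := hK.exists_of_one_le_norm
  obtain ⟨C, γ, hC, hγ, hdecay⟩ := DissipativeFamily.exists_ae_norm_sq_le_exp m hM hc ht₀
  refine ⟨C, γ, hC, hγ, fun {U₀ U} hU {σ t} hσ ht => ?_⟩
  refine hdecay (hfamily hσ) (fun φ _ => (isMultiplicationBy_annulusA hσ).commute_smulOp φ)
    (fun φ _ => (isMultiplicationBy_compOp _).commute_smulOp φ) (fun s hs f => ?_) (by positivity)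
    (hU.isDissipativeSolution_annulusFourier hσ (hfamily hσ).slowlyVarying_left.continuousOn
      (hfamily hσ).slowlyVarying_right.continuousOn) ht
  refine (mul_norm_sq_le_sum_annulus hσ (hlower s hs) f).trans ?_
  exact Finset.sum_le_sum_of_subset_of_nonneg (Finset.range_mono m.le_succ) fun _ _ _ => by
    positivity

theorem exists_ae_norm_sq_fourier_le (hn : 0 < n)
    (hA : ∀ k, ∃ M, SlowlyVarying M fun t => Matrix.toEuclideanCLM (𝕜 := ℂ) (A k t))
    (hB : ∃ M, SlowlyVarying M fun t => Matrix.toEuclideanCLM (𝕜 := ℂ) (B t))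
    (hAB : CondB1 A B) (hK : UniformKalman m A B) :
    ∃ C γ : ℝ, 0 < C ∧ 0 < γ ∧ ∀ {U₀ : 𝓢'(Rn n, Cd d)}
      {U : ℝ → Lp (Cd d) 2 (volume : Measure (Rn n))}, IsSolution A B U₀ U →
      ∀ {t : ℝ}, 0 ≤ t →
        ∀ᵐ ξ, ‖(𝓕 (U t) : Lp (Cd d) 2 (volume : Measure (Rn n))) ξ‖ ^ 2 ≤
          C * Real.exp (-γ * (‖ξ‖ ^ 2 / (1 + ‖ξ‖ ^ 2)) * t) *
            ‖(𝓕 (U 0) : Lp (Cd d) 2 (volume : Measure (Rn n))) ξ‖ ^ 2 := by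
  obtain ⟨C, γ, hC, hγ, hannulus⟩ := exists_ae_norm_sq_annulusFourier_le hA hB hAB hK
  refine ⟨C, γ, hC, hγ, fun {U₀ U} hU {t} ht => ?_⟩
  have hdecay (a : {a : ℚ // 0 < a}) : ∀ᵐ ξ, ξ ∈ annulus n (a : ℚ) →
      ‖(𝓕 (U t) : Lp (Cd d) 2 (volume : Measure (Rn n))) ξ‖ ^ 2 ≤
        C * Real.exp (-γ * (‖ξ‖ ^ 2 / (1 + ‖ξ‖ ^ 2)) * t) *
          ‖(𝓕 (U 0) : Lp (Cd d) 2 (volume : Measure (Rn n))) ξ‖ ^ 2 := by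
    have ha : (0 : ℝ) < (a : ℚ) := Rat.cast_pos.2 a.2
    rw [← ae_restrict_iff' (isOpen_annulus n _).measurableSet]
    filter_upwards [hannulus hU ha ht, coeFn_annulusFourier _ U t, coeFn_annulusFourier _ U 0,
      ae_mem_annulus n _] with ξ hle hcoe hcoe₀ hξ
    rw [← hcoe, ← hcoe₀]
    refine hle.trans ?_
    have hξa : ‖ξ‖ ≤ 2 * Real.pi * (a : ℚ) := hξ.2.le.trans
      (mul_le_mul_of_nonneg_right (by linarith [Real.pi_gt_three]) ha.le)
    gcongr C * Real.exp (?_ * t) * _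
    exact mul_le_mul_of_nonpos_left (sq_div_one_add_sq_le (norm_nonneg ξ) hξa) (by linarith)
  filter_upwards [ae_all_iff.2 hdecay, ae_exists_rat_mem_annulus hn] with ξ hle ⟨a, ha⟩
  exact hle a ha

end

/-! ### The estimate -/

theorem exists_one_add_rpow_mul_exp_le {s γ : ℝ} (hs : 0 ≤ s) (hγ : 0 < γ) :
    ∃ K : ℝ, 0 < K ∧ ∀ x, 0 ≤ x → (1 + x) ^ s * Real.exp (-γ * x) ≤ K := by
  set δ := γ / (s + 1)
  have hδ : 0 < δ := by positivity
  have hsδ : s * δ ≤ γ := by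
    rw [mul_div_assoc', div_le_iff₀ (by positivity)]
    linarith
  refine ⟨(1 + 1 / δ) ^ s, by positivity, fun x hx => ?_⟩
  have hexp : 1 + x ≤ (1 + 1 / δ) * Real.exp (δ * x) :=
    calc 1 + x = 1 + 1 / δ * (δ * x) := by field_simp
      _ ≤ Real.exp (δ * x) + 1 / δ * Real.exp (δ * x) := by
        have : 0 ≤ δ * x := by positivity
        gcongr <;> linarith [Real.add_one_le_exp (δ * x)]
      _ = _ := by ring
  calc (1 + x) ^ s * Real.exp (-γ * x)
      ≤ ((1 + 1 / δ) * Real.exp (δ * x)) ^ s * Real.exp (-γ * x) := by gcongr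
    _ = (1 + 1 / δ) ^ s * Real.exp ((s * δ - γ) * x) := by
        rw [Real.mul_rpow (by positivity) (by positivity), ← Real.exp_mul, mul_assoc,
          ← Real.exp_add]
        ring_nf
    _ ≤ (1 + 1 / δ) ^ s := mul_le_of_le_one_right (by positivity)
        (Real.exp_le_one_iff.2 (mul_nonpos_of_nonpos_of_nonneg (by linarith) hx))

theorem exists_scaledWeight_mul_exp_le {s γ : ℝ} (hs : 0 ≤ s) (hγ : 0 < γ) :
    ∃ K : ℝ, 0 < K ∧ ∀ {E : Type*} [Norm E] (ξ : E) {t : ℝ}, 0 ≤ t →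
      scaledWeight (1 + t) s ξ * Real.exp (-γ * (‖ξ‖ ^ 2 / (1 + ‖ξ‖ ^ 2)) * t) ≤
        K * scaledWeight 1 s ξ := by
  obtain ⟨K, hK, hle⟩ := exists_one_add_rpow_mul_exp_le hs hγ
  refine ⟨K, hK, fun {E _} ξ {t} ht => ?_⟩
  set x := ‖ξ‖ ^ 2 / (1 + ‖ξ‖ ^ 2) * t
  have hx : 0 ≤ x := by positivity
  have hfactor : scaledWeight (1 + t) s ξ = scaledWeight 1 s ξ * (1 + x) ^ s := by
    rw [scaledWeight, scaledWeight, ← Real.mul_rpow (by positivity) (by positivity)]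
    congr 1
    simp only [x]
    field_simp
    ring
  rw [hfactor, mul_assoc (-γ), mul_assoc, mul_comm K]
  exact mul_le_mul_of_nonneg_left (hle x hx) (scaledWeight_pos zero_le_one s ξ).le

theorem scaledWeight_one_le_norm_japaneseSymbol {n : ℕ} {r : ℝ} (hr : 0 ≤ r) (ξ : Rn n) :
    scaledWeight 1 (r / 2) ξ ≤ ‖japaneseSymbol r ξ‖ := by
  rw [japaneseSymbol, Complex.norm_real, Real.norm_of_nonneg (by positivity), scaledWeight]
  gcongr
  rw [one_mul]
  exact pow_le_pow_left₀ (norm_nonneg ξ)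
    (le_mul_of_one_le_left (norm_nonneg ξ) (by linarith [Real.pi_gt_three])) 2

theorem exists_scaledWeight_mul_le {r₁ r₂ C γ : ℝ} (hr : 0 ≤ r₁ + r₂) (hC : 0 < C) (hγ : 0 < γ) :
    ∃ K : ℝ, 0 < K ∧ ∀ {n : ℕ} (ξ : Rn n) {t x y : ℝ}, 0 ≤ t → 0 ≤ x →
      y ^ 2 ≤ C * Real.exp (-γ * (‖ξ‖ ^ 2 / (1 + ‖ξ‖ ^ 2)) * t) * x ^ 2 →
      scaledWeight (1 + t) (r₁ / 2) ξ * y ≤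
        K * (scaledWeight (1 + t) (-(r₂ / 2)) ξ * ‖japaneseSymbol (r₁ + r₂) ξ‖ * x) := by
  obtain ⟨K, hK, hle⟩ := exists_scaledWeight_mul_exp_le
    (s := (r₁ + r₂) / 2) (by positivity) (half_pos hγ)
  refine ⟨√C * K, by positivity, fun {n} ξ {t x y} ht hx hy => ?_⟩
  set ε := Real.exp (-(γ / 2) * (‖ξ‖ ^ 2 / (1 + ‖ξ‖ ^ 2)) * t)
  have hε : Real.exp (-γ * (‖ξ‖ ^ 2 / (1 + ‖ξ‖ ^ 2)) * t) = ε ^ 2 := by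
    rw [← Real.exp_nat_mul]
    congr 1
    push_cast
    ring
  have hyx : y ≤ √C * ε * x := by
    refine le_of_sq_le_sq (hy.trans_eq ?_) (by positivity)
    rw [hε, mul_pow, mul_pow, Real.sq_sqrt hC.le]
  have hT : 0 ≤ 1 + t := by positivity
  have hw₁ := (scaledWeight_pos hT (r₁ / 2) ξ).le
  have hw₂ := (scaledWeight_pos hT (-(r₂ / 2)) ξ).le
  calc scaledWeight (1 + t) (r₁ / 2) ξ * y ≤ scaledWeight (1 + t) (r₁ / 2) ξ * (√C * ε * x) := by
        gcongr
    _ = √C * (scaledWeight (1 + t) (-(r₂ / 2)) ξ *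
          (scaledWeight (1 + t) ((r₁ + r₂) / 2) ξ * ε)) * x := by
        rw [show r₁ / 2 = -(r₂ / 2) + (r₁ + r₂) / 2 by ring, scaledWeight_add hT]
        ring
    _ ≤ √C * (scaledWeight (1 + t) (-(r₂ / 2)) ξ *
          (K * ‖japaneseSymbol (r₁ + r₂) ξ‖)) * x := by
        gcongr √C * (_ * ?_) * x
        exact (hle ξ ht).trans
          (mul_le_mul_of_nonneg_left (scaledWeight_one_le_norm_japaneseSymbol hr ξ) hK.le)
    _ = _ := by ring

theorem ae_eq_of_smulLeftCLM_eq {E F : Type*} [NormedAddCommGroup E] [InnerProductSpace ℝ E]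
    [FiniteDimensional ℝ E] [MeasurableSpace E] [BorelSpace E] [NormedAddCommGroup F]
    [InnerProductSpace ℂ F] [CompleteSpace F] {a : E → ℂ} (ha : a.HasTemperateGrowth)
    {f h : Lp F 2 (volume : Measure E)} (hf : smulLeftCLM F a (h : 𝓢'(E, F)) = f) :
    ∀ᵐ ξ : E, f ξ = a ξ • h ξ := by
  have hloc (u : Lp F 2 (volume : Measure E)) : LocallyIntegrable u volume :=
    (Lp.memLp u).locallyIntegrable (by norm_num)
  refine ae_eq_of_integral_contDiff_smul_eq (hloc f)
    ((hloc h).continuous_smul ha.1.continuous) fun g hg hgc => ?_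
  have hgcℂ : HasCompactSupport fun ξ => (g ξ : ℂ) :=
    hgc.comp_left (g := fun x : ℝ => (x : ℂ)) Complex.ofReal_zero
  let ψ : 𝓢(E, ℂ) := hgcℂ.toSchwartzMap (Complex.ofRealCLM.contDiff.comp hg)
  have hψ (ξ : E) : ψ ξ = (g ξ : ℂ) := rfl
  have happly := DFunLike.congr_fun hf ψ
  simp only [smulLeftCLM_apply_apply, Lp.toTemperedDistribution_apply,
    SchwartzMap.smulLeftCLM_apply_apply ha] at happly
  calc ∫ ξ, g ξ • f ξ = ∫ ξ, ψ ξ • f ξ := by simp only [hψ, Complex.coe_smul]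
    _ = ∫ ξ, (a ξ • ψ ξ) • h ξ := happly.symm
    _ = ∫ ξ, g ξ • a ξ • h ξ := by
        simp only [hψ, smul_eq_mul, mul_smul, Complex.coe_smul, smul_comm (a _)]

section

variable {n d m : ℕ} {A : Fin n → ℝ → Matrix (Fin d) (Fin d) ℂ}
  {B : ℝ → Matrix (Fin d) (Fin d) ℂ}

theorem IsSolution.smulLeftCLM_japaneseSymbol_fourier {U₀ : 𝓢'(Rn n, Cd d)}
    {U : ℝ → Lp (Cd d) 2 (volume : Measure (Rn n))} (hU : IsSolution A B U₀ U) {r : ℝ}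
    {u : 𝓢'(Rn n, Cd d)} (hu : japaneseOp n d r U₀ = u) :
    smulLeftCLM (Cd d) (japaneseSymbol r)
      ((𝓕 (U 0) : Lp (Cd d) 2 (volume : Measure (Rn n))) : 𝓢'(Rn n, Cd d)) = 𝓕 u := by
  rw [← hu, japaneseOp, fourierMultiplierCLM_apply, FourierTransform.fourier_fourierInv_eq,
    ← hU.initial, Lp.fourier_toTemperedDistribution_eq]

theorem exists_eLpNorm_scaledWeight_smul_fourier_le (hn : 0 < n)
    (hA : ∀ k, ∃ M, SlowlyVarying M fun t => Matrix.toEuclideanCLM (𝕜 := ℂ) (A k t))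
    (hB : ∃ M, SlowlyVarying M fun t => Matrix.toEuclideanCLM (𝕜 := ℂ) (B t))
    (hAB : CondB1 A B) (hK : UniformKalman m A B) {p : ℝ≥0∞} [Fact (1 ≤ p)] (hp : p ≤ 2)
    {r₁ r₂ : ℝ} (hr : 0 ≤ r₁ + r₂) (hr₂ : (n : ℝ) * ((p⁻¹).toReal - 1 / 2) ≤ r₂)
    (hr₂' : p = 1 → (n : ℝ) * ((p⁻¹).toReal - 1 / 2) < r₂) :
    ∃ C : ℝ, 0 < C ∧ ∀ {U₀ : 𝓢'(Rn n, Cd d)} {U : ℝ → Lp (Cd d) 2 (volume : Measure (Rn n))},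
      IsSolution A B U₀ U → ∀ {g : Lp (Cd d) p (volume : Measure (Rn n))},
      japaneseOp n d (r₁ + r₂) U₀ = g → ∀ {t : ℝ}, 0 ≤ t →
        eLpNorm (fun ξ => scaledWeight (1 + t) (r₁ / 2) ξ •
            (𝓕 (U t) : Lp (Cd d) 2 (volume : Measure (Rn n))) ξ) 2 volume ≤
          ENNReal.ofReal (C * (1 + t) ^ (-((n : ℝ) / 2 * ((p⁻¹).toReal - 1 / 2)))) * ‖g‖ₑ := by
  have : NeZero n := ⟨hn.ne'⟩
  obtain ⟨C, γ, hC, hγ, hdecay⟩ := exists_ae_norm_sq_fourier_le hn hA hB hAB hK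
  obtain ⟨K, hK₀, hweight⟩ := exists_scaledWeight_mul_le hr hC hγ
  obtain ⟨L, hL, hinitial⟩ := exists_smulLeftCLM_fourier_eq (E := Rn n) (F := Cd d) hp
    (ρ := r₂) (by simpa using hr₂) (by simpa using hr₂')
  refine ⟨K * L, by positivity, fun {U₀ U} hU {g} hg {t} ht => ?_⟩
  have hT : 0 < 1 + t := by positivity
  obtain ⟨f, hf, hfg⟩ := hinitial g (1 + t) hT
  have hw := scaledWeight_hasTemperateGrowth (E := Rn n) hT.le (-(r₂ / 2))
  have hJ := japaneseSymbol_hasTemperateGrowth (n := n) (r₁ + r₂)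
  rw [← hU.smulLeftCLM_japaneseSymbol_fourier hg, smulLeftCLM_smulLeftCLM_apply hJ hw,
    mul_comm] at hf
  have hbound : ∀ᵐ ξ : Rn n, ‖scaledWeight (1 + t) (r₁ / 2) ξ •
      (𝓕 (U t) : Lp (Cd d) 2 (volume : Measure (Rn n))) ξ‖ ≤ K * ‖f ξ‖ := by
    filter_upwards [hdecay hU ht, ae_eq_of_smulLeftCLM_eq (hw.mul hJ) hf] with ξ hξ hfξ
    rw [hfξ, norm_smul, norm_smul, Pi.mul_apply, norm_mul, Complex.norm_real,
      Real.norm_of_nonneg (scaledWeight_pos hT.le _ ξ).le,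
      Real.norm_of_nonneg (scaledWeight_pos hT.le _ ξ).le]
    exact hweight ξ ht (norm_nonneg _) hξ
  refine (eLpNorm_le_mul_eLpNorm_of_ae_le_mul hbound 2).trans ?_
  rw [← Lp.enorm_def, ← ofReal_norm, ← ofReal_norm, ← ENNReal.ofReal_mul hK₀.le,
    ← ENNReal.ofReal_mul (by positivity)]
  refine ENNReal.ofReal_le_ofReal ?_
  rw [finrank_euclideanSpace_fin] at hfg
  calc K * ‖f‖ ≤ K * (L * (1 + t) ^ (-((n : ℝ) / 2 * ((p⁻¹).toReal - 1 / 2))) * ‖g‖) := by gcongr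
    _ = _ := by ring

end

theorem exists_eq_add_of_add_le {a b r : ℝ} (h : a + b ≤ r) :
    ∃ r₁ r₂, r = r₁ + r₂ ∧ a ≤ r₁ ∧ b ≤ r₂ ∧ (a + b < r → a < r₁ ∧ b < r₂) :=
  ⟨(r + a - b) / 2, (r - a + b) / 2, by ring, by linarith, by linarith,
    fun _ => ⟨by linarith, by linarith⟩⟩

end PartDiss

open PartDiss in
open scoped FourierTransform in
theorem mainTheorem8_general {n d m : ℕ} (hn : 0 < n)
    (A : Fin n → ℝ → Matrix (Fin d) (Fin d) ℂ) (B : ℝ → Matrix (Fin d) (Fin d) ℂ)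
    (hA : ∀ k i j, ∃ M, SlowlyVarying M fun t => A k t i j)
    (hB : ∀ i j, ∃ M, SlowlyVarying M fun t => B t i j)
    (hAB : CondB1 A B) (hK : UniformKalman m A B)
    (p q : ℝ≥0∞) [hp₁ : Fact (1 ≤ p)] (hp : p ≤ 2) (hq : 2 ≤ q)
    (r : ℝ) (hr : (n : ℝ) * ((p⁻¹).toReal - (q⁻¹).toReal) ≤ r)
    (hr' : p = 1 ∨ q = ⊤ → (n : ℝ) * ((p⁻¹).toReal - (q⁻¹).toReal) < r) :
    ∃ C : ℝ, 0 < C ∧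
      ∀ (U₀ : 𝓢'(Rn n, Cd d)) (U : ℝ → Lp (Cd d) 2 (volume : Measure (Rn n))),
        MemLpr p r U₀ → IsSolution A B U₀ U → ∀ t : ℝ, 0 ≤ t →
          eLpNorm (U t) q volume ≤
            ENNReal.ofReal (C * (1 + t) ^ (-((n : ℝ) / 2 * ((p⁻¹).toReal - (q⁻¹).toReal)))) *
              lprNorm p r U₀ := by
  have : NeZero n := ⟨hn.ne'⟩
  have hsum : (n : ℝ) * (1 / 2 - (q⁻¹).toReal) + n * ((p⁻¹).toReal - 1 / 2) =
    n * ((p⁻¹).toReal - (q⁻¹).toReal) := by ring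
  obtain ⟨r₁, r₂, rfl, hr₁, hr₂, hlt⟩ := exists_eq_add_of_add_le (hsum.trans_le hr)
  rw [hsum] at hlt
  have hpq : (q⁻¹).toReal ≤ (p⁻¹).toReal :=
    ENNReal.toReal_mono (ENNReal.inv_ne_top.2 (zero_lt_one.trans_le hp₁.out).ne')
      (ENNReal.inv_le_inv.2 (hp.trans hq))
  have hr₀ : 0 ≤ r₁ + r₂ := (mul_nonneg n.cast_nonneg (sub_nonneg.2 hpq)).trans hr
  obtain ⟨C₁, hC₁, hfourier⟩ := exists_eLpNorm_scaledWeight_smul_fourier_le hn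
    (fun k => exists_slowlyVarying_toEuclideanCLM (hA k)) (exists_slowlyVarying_toEuclideanCLM hB)
    hAB hK hp hr₀ hr₂ fun h => (hlt (hr' (.inl h))).2
  obtain ⟨C₂, hC₂, hinverse⟩ := IsFourierContraction.exists_eLpNorm_le_scaledWeight_smul
    (μ := (volume : Measure (Rn n))) (ν := (volume : Measure (Rn n))) (F := Cd d) (G := Cd d) hq
    (ρ := r₁) (by simpa using hr₁) (by simpa using fun h => (hlt (hr' (.inr h))).1)
  refine ⟨C₂ * C₁, by positivity, fun U₀ U ⟨g, hg⟩ hU t ht => ?_⟩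
  have hT : 0 < 1 + t := by positivity
  have hUt := hinverse _ isFourierContraction_fourierTransform_symm (𝓕 (U t)) _ hT
  have hsymm : (Lp.fourierTransformₗᵢ (Rn n) (Cd d)).symm (𝓕 (U t)) = U t :=
    (Lp.fourierTransformₗᵢ (Rn n) (Cd d)).symm_apply_apply (U t)
  rw [AddMonoidHom.coe_coe, hsymm, finrank_euclideanSpace_fin] at hUt
  rw [lprNorm_eq p _ U₀ g hg]
  refine (hUt.trans (mul_le_mul_right (hfourier hU hg ht) _)).trans_eq ?_
  rw [← mul_assoc, ← ENNReal.ofReal_mul (by positivity), mul_mul_mul_comm, ← Real.rpow_add hT]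
  ring_nf

theorem mainTheorem8 {n d : ℕ} (hn : 0 < n) [NeZero d]
    (A : Fin n → ℝ → Matrix (Fin d) (Fin d) ℂ) (B : ℝ → Matrix (Fin d) (Fin d) ℂ)
    (hA : ∀ k, PartDiss.MatTClass 0 (A k)) (hB : PartDiss.MatTClass 0 B)
    (hB1 : PartDiss.CondB1 A B) (hB2 : PartDiss.CondB2 B) (hB3 : PartDiss.CondB3 A B)
    (p q : ℝ≥0∞) [Fact (1 ≤ p)] (hp : p ≤ 2) (hq : 2 ≤ q)
    (r : ℝ) (hr : (n : ℝ) * ((p⁻¹).toReal - (q⁻¹).toReal) ≤ r)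
    (hr' : p = 1 ∨ q = ⊤ → (n : ℝ) * ((p⁻¹).toReal - (q⁻¹).toReal) < r) :
    ∃ C : ℝ, 0 < C ∧
      ∀ (U₀ : 𝓢'(PartDiss.Rn n, PartDiss.Cd d))
        (U : ℝ → Lp (PartDiss.Cd d) 2 (volume : Measure (PartDiss.Rn n))),
        PartDiss.MemLpr p r U₀ → PartDiss.IsSolution A B U₀ U →
        ∀ t : ℝ, 0 ≤ t →
          eLpNorm (U t) q volume ≤
            ENNReal.ofReal
                (C * (1 + t) ^ (-((n : ℝ) / 2 * ((p⁻¹).toReal - (q⁻¹).toReal)))) *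
              PartDiss.lprNorm p r U₀ := by
  exact mainTheorem8_general hn A B (fun k i j => (hA k i j).exists_slowlyVarying)
    (fun i j => (hB i j).exists_slowlyVarying) hB1 hB3.uniformKalman p q hp hq r hr hr'
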